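/- Let $\mathbb F$ be a field of characteristic not equal to $2$ and let $\alpha,\beta\in\mathbb F\setminus\{0,1\}$ be distinct. All algebras are commutative, not necessarily associative or unital. **Axes.** Let $A$ be an $\mathbb F$-algebra; for $a\in A$ and $\mu\in\mathbb F$ put $A_\mu(a)=\{x\in A: ax=\mu x\}$, and $A_S(a)=\sum_{\mu\in S}A_\mu(a)$ for $S\subseteq\mathbb F$. The fusion law $\mathcal M(\alpha,\beta)$ is the symmetric map $\star$ on $\{1,0,\alpha,\beta\}$ with $1\star1=\{1\}$, $0\star0=\{0\}$, $1\star0=\emptyset$, $1\star\alpha=0\star\alpha=\{\alpha\}$, $1\star\beta=0\star\beta=\alpha\star\beta=\{\beta\}$, $\alpha\star\alpha=\{1,0\}$, $\beta\star\beta=\{1,0,\alpha\}$. A (primitive) $\mathcal M(\alpha,\beta)$-axis is an element $a=a^2$ with $A=A_{\{1,0,\alpha,\beta\}}(a)$, $A_\lambda(a)A_\mu(a)\subseteq A_{\lambda\star\mu}(a)$ for all $\lambda,\mu\in\{1,0,\alpha,\beta\}$, and $A_1(a)=\mathbb Fa$. Its Miyamoto involution $\tau_a$ is the automorphism of $A$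 acting as $1$ on $A_{\{1,0,\alpha\}}(a)$ and as $-1$ on $A_\beta(a)$. A $2$-generated primitive $\mathcal M(\alpha,\beta)$-axial algebra is a pair $(A,X)$ where $X$ is a set of two such axes that generates the algebra $A$. Its axet $\langle X\rangle$ is the smallest set of $\mathcal M(\alpha,\beta)$-axes of $A$ that contains $X$ and is invariant under $\tau_y$ for each of its members $y$, together with the involutions $\tau_y$. The skew axet $X'(1+2)$ has three points $a,b,c$, where $\tau_a$ fixes $a$ and interchanges $b$ and $c$, while $\tau_b$ and $\tau_c$ fix all three points (the square with two opposite vertices identified). An isomorphism of axets is a bijection of the points that carries the permutation induced by each $\tau_x$ to the one induced by the involution of the image of $x$. **Algebras.** For $\eta\in\mathbb F$, $3\mathrm C(\eta)$ has a basis of idempotents $x,y,z$ with $xy=\frac\eta2(x+y-z)$, $yz=\frac\eta2(y+z-x)$, $xz=\frac\eta2(x+z-y)$. As an algebra, $3\mathrm C(\alpha,1-\alpha)$ is $3\mathrm C(\alpha)$ if $\alpha\ne-1$ and $3\mathrm C(2)$ if $\alpha=-1$. If $\operatorname{char}\mathbb F\neq 3$, the algebra $Q_2(\frac13,\frac23)$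 has a basis of idempotents $s_1,s_2,d_1,d_2$ with $s_1s_2=0$, $s_id_1=\frac13s_i+\frac16d_1-\frac16d_2$ and $s_id_2=\frac13s_i-\frac16d_1+\frac16d_2$ for $i=1,2$, and $d_1d_2=\frac13(-s_1-s_2+d_1+d_2)$. If $\operatorname{char}\mathbb F=5$, the algebra $Q_2(\frac13)^\times\oplus\langle\mathbb 1\rangle$ has a basis $x,y,z,\mathbb 1$ where $\mathbb 1$ is an identity element, $x,y,z$ are idempotents, $xy=0$, $xz=3x+y+2z$, $yz=x+3y+2z$. **Theorem.** Let $(A,X)$ be a $2$-generated primitive $\mathcal M(\alpha,\beta)$-axial algebra over $\mathbb F$ such that $\langle X\rangle$ is isomorphic to $X'(1+2)$. Then, up to isomorphism of algebras, at least one of the following holds: 1. $A\cong 3\mathrm C(\alpha,1-\alpha)$, with $\alpha\neq\frac12$ and $\alpha+\beta=1$; or 2. $\operatorname{char}\mathbb F\ne 3$, $(\alpha,\beta)=(\frac13,\frac23)$, and (i) if $\operatorname{char}\mathbb F\neq5$, then $A\cong Q_2(\frac13,\frac23)$; (ii) if $\operatorname{char}\mathbb F=5$, then $A\cong Q_2(\frac13)^\times\oplus\langle\mathbb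 1\rangle$. -/

import Mathlib

namespace SkewAxial

set_option linter.unusedSectionVars false

open scoped Pointwise

/-! ## Axets -/

/-- An `S`-axet `(G, X, τ)`: the group `G` acts on `X`, every `τ x` is a homomorphism from `S` to
the stabilizer of `x`, and `τ` is equivariant. (The action is written on the left, so the conjugate
of `τ x s` by `g` is `g * τ x s * g⁻¹`.) -/
structure Axet (S G X : Type*) [Group S] [Group G] [MulAction G X] where
  τ : X → S → G
  fixes : ∀ x s, τ x s • x = x
  map_mul : ∀ x s s', τ x (s * s') = τ x s * τ x s'
  equivariant : ∀ (g : G) (x : X) (s : S), τ (g • x) s = g * τ x s * g⁻¹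

namespace Axet

variable {S G X : Type*} [Group S] [Group G] [MulAction G X]

/-- A subset is closed if it is invariant under the axial subgroups of its elements. -/
def IsClosed (𝒳 : Axet S G X) (Y : Set X) : Prop :=
  ∀ y ∈ Y, ∀ s, ∀ z ∈ Y, 𝒳.τ y s • z ∈ Y

/-- The closure `⟨Z⟩` of `Z`: the smallest closed subset containing `Z`. -/
def closure (𝒳 : Axet S G X) (Z : Set X) : Set X :=
  ⋂₀ {Y | 𝒳.IsClosed Y ∧ Z ⊆ Y}

theorem isClosed_closure (𝒳 : Axet S G X) (Z : Set X) : 𝒳.IsClosed (𝒳.closure Z) := by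
  intro y hy s z hz Y hY
  exact hY.1 y (hy Y hY) s z (hz Y hY)

theorem subset_closure (𝒳 : Axet S G X) (Z : Set X) : Z ⊆ 𝒳.closure Z :=
  fun _ hz _ hY => hY.2 hz

theorem map_one (𝒳 : Axet S G X) (x : X) : 𝒳.τ x 1 = 1 := by
  have h := 𝒳.map_mul x 1 1
  rw [mul_one] at h
  exact (mul_eq_left.mp h.symm)

theorem mem_stabilizer (𝒳 : Axet S G X) {Y : Set X} (hY : 𝒳.IsClosed Y) {y : X} (hy : y ∈ Y)
    (s : S) : 𝒳.τ y s ∈ MulAction.stabilizer G Y := by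
  rw [MulAction.mem_stabilizer_iff]
  apply Set.Subset.antisymm
  · rintro _ ⟨z, hz, rfl⟩
    exact hY y hy s z hz
  · intro z hz
    refine ⟨𝒳.τ y s⁻¹ • z, hY y hy _ z hz, ?_⟩
    change 𝒳.τ y s • 𝒳.τ y s⁻¹ • z = z
    rw [smul_smul, ← 𝒳.map_mul, mul_inv_cancel, 𝒳.map_one, one_smul]

/-- The axet `(G_Y, Y, τ')` on a closed subset `Y`, where `G_Y` is the setwise stabilizer. -/
def restrict (𝒳 : Axet S G X) (Y : Set X) (hY : 𝒳.IsClosed Y) :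
    Axet S (MulAction.stabilizer G Y) Y where
  τ y s := ⟨𝒳.τ y s, 𝒳.mem_stabilizer hY y.2 s⟩
  fixes y s := Subtype.ext (𝒳.fixes y s)
  map_mul y s s' := Subtype.ext (𝒳.map_mul y s s')
  equivariant g y s := Subtype.ext (𝒳.equivariant g y s)

/-- Two `S`-axets are isomorphic if some bijection between their point sets matches the
permutations `τ x s` of the points. (The ambient groups, which need not act faithfully, are not
compared.) -/
def IsIsomorphic {G' X' : Type*} [Group G'] [MulAction G' X']
    (𝒳 : Axet S G X) (𝒳' : Axet S G' X') : Prop :=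
  ∃ e : X ≃ X', ∀ x s y, e (𝒳.τ x s • y) = 𝒳'.τ (e x) s • e y

end Axet

/-! ## The skew axet `X'(1+2)` -/

/-- The points of `X'(1+2)`: the vertices `a, b, a, c` of a square (in cyclic order), with the two
opposite vertices labelled `a` identified. -/
inductive SkewPoint : Type
  | a | b | c
  deriving DecidableEq

/-- The permutation of the points that interchanges `b` and `c`. -/
def SkewPoint.flip : SkewPoint → SkewPoint
  | .a => .a
  | .b => .c
  | .c => .b

theorem SkewPoint.flip_flip (p : SkewPoint) : p.flip.flip = p := by
  cases p <;> rfl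

/-- The dihedral group of order `4`, as `C₂ × C₂`. The generator of the first factor is the
reflection of the square at a vertex `a`, that of the second factor is the reflection at `b`, which
acts trivially after the identification. -/
instance : MulAction (ℤˣ × ℤˣ) SkewPoint where
  smul g p := if g.1 = 1 then p else p.flip
  one_smul p := by change (if (1 : ℤˣ) = 1 then p else p.flip) = p; simp
  mul_smul g h p := by
    change (if g.1 * h.1 = 1 then p else p.flip) =
      if g.1 = 1 then (if h.1 = 1 then p else p.flip)
      else (if h.1 = 1 then p else p.flip).flip
    rcases Int.units_eq_one_or g.1 with hg | hg <;> rcases Int.units_eq_one_or h.1 with hh | hh <;>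
      simp [hg, hh, SkewPoint.flip_flip]

/-- The involution attached to a point, as an element of the dihedral group of order `4`. -/
def skewTau : SkewPoint → ℤˣ → ℤˣ × ℤˣ
  | .a, s => (s, 1)
  | .b, s => (1, s)
  | .c, s => (1, s)

/-- The skew axet `X'(1+2)`. -/
def skewAxet : Axet ℤˣ (ℤˣ × ℤˣ) SkewPoint where
  τ := skewTau
  fixes := by
    intro x s
    change (if (skewTau x s).1 = 1 then x else x.flip) = x
    cases x
    · exact ite_eq_left_iff.2 fun _ => rfl
    · exact if_pos rfl
    · exact if_pos rfl
  map_mul := by intro x s s'; cases x <;> simp [skewTau]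
  equivariant := by
    intro g x s
    change skewTau (if g.1 = 1 then x else x.flip) s = _
    rw [mul_comm g, mul_inv_cancel_right]
    split_ifs <;> cases x <;> rfl

/-- Sanity check: `X'(1+2)` is the quotient of the axet of the square, in which the reflection at
the vertex `i` is `j ↦ 2 i - j`, by the identification of the two even vertices. -/
theorem skewAxet_eq_quotient_square :
    ∃ π : ZMod 4 → SkewPoint, Function.Surjective π ∧
      (∀ i j, π i = π j ↔ i = j ∨ ((i = 0 ∨ i = 2) ∧ j = i + 2)) ∧
      ∀ i j, π (2 * i - j) = skewAxet.τ (π i) (-1) • π j := by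
  let π : ZMod 4 → SkewPoint := fun i => if i = 1 then .b else if i = 3 then .c else .a
  refine ⟨π, ?_, by decide, by decide⟩
  intro p
  cases p
  exacts [⟨0, by decide⟩, ⟨1, by decide⟩, ⟨3, by decide⟩]

/-! ## Axes and axial algebras of Monster type -/

/-- The four elements `1, 0, α, β` of the Monster fusion law. -/
inductive MonsterLabel : Type
  | one | zero | alpha | beta
  deriving DecidableEq

namespace MonsterLabel

/-- The element of the field denoted by a label. -/
def value {F : Type*} [Zero F] [One F] (α β : F) : MonsterLabel → F
  | one => 1
  | zero => 0
  | alpha => α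
  | beta => β

/-- The fusion law `M(α, β)`. -/
def star : MonsterLabel → MonsterLabel → Set MonsterLabel
  | zero, zero => {zero}
  | zero, one => ∅
  | zero, alpha => {alpha}
  | zero, beta => {beta}
  | one, zero => ∅
  | one, one => {one}
  | one, alpha => {alpha}
  | one, beta => {beta}
  | alpha, zero => {alpha}
  | alpha, one => {alpha}
  | alpha, alpha => {one, zero}
  | alpha, beta => {beta}
  | beta, zero => {beta}
  | beta, one => {beta}
  | beta, alpha => {beta}
  | beta, beta => {one, zero, alpha}

/-- The `C₂`-grading of the Monster fusion law. -/
def grade : MonsterLabel → ℤˣ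
  | one => 1
  | zero => 1
  | alpha => 1
  | beta => -1

theorem grade_star : ∀ i j k, k ∈ star i j → grade k = grade i * grade j := by
  intro i j k h
  cases i <;> cases j <;> cases k <;> simp_all [star, grade]

end MonsterLabel

/-- The four elements `1, 0, α, β` are pairwise distinct. -/
structure IsMonsterPair {F : Type*} [Field F] (α β : F) : Prop where
  alpha_ne_zero : α ≠ 0
  alpha_ne_one : α ≠ 1
  beta_ne_zero : β ≠ 0
  beta_ne_one : β ≠ 1
  alpha_ne_beta : α ≠ β

section Algebra

variable {F A : Type*} [Field F] [NonUnitalNonAssocCommRing A] [Module F A]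
  [SMulCommClass F A A] [IsScalarTower F A A]

variable (F) in
/-- The `μ`-eigenspace `A_μ(a)` of the adjoint map `x ↦ a * x`. -/
def eigen (a : A) (μ : F) : Submodule F A :=
  Module.End.eigenspace (LinearMap.mulLeft F a) μ

theorem mem_eigen {a v : A} {μ : F} : v ∈ eigen F a μ ↔ a * v = μ • v := by
  simp [eigen]

/-- The sum of the eigenspaces `A_i(a)` over the labels `i ∈ S`. -/
def eigenSum (α β : F) (a : A) (S : Set MonsterLabel) : Submodule F A :=
  ⨆ i ∈ S, eigen F a (i.value α β)

/-- `a` is a primitive `M(α, β)`-axis. (The sum in `semisimple` is direct when `1, 0, α, β` are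
distinct, since eigenspaces for distinct eigenvalues are independent.) -/
structure IsAxis (α β : F) (a : A) : Prop where
  idem : a * a = a
  semisimple : eigenSum α β a Set.univ = ⊤
  fusion : ∀ i j : MonsterLabel, ∀ x ∈ eigen F a (i.value α β), ∀ y ∈ eigen F a (j.value α β),
    x * y ∈ eigenSum α β a (MonsterLabel.star i j)
  primitive : eigen F a 1 = Submodule.span F {a}

/-- `(A, X)` is a primitive `M(α, β)`-axial algebra. -/
structure IsAxialAlgebra (α β : F) (X : Set A) : Prop where
  axes : ∀ a ∈ X, IsAxis α β a
  generates : NonUnitalAlgebra.adjoin F X = ⊤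

variable (F A) in
/-- The automorphism group of the algebra `A`. -/
def Aut : Subgroup (A ≃ₗ[F] A) where
  carrier := {g | ∀ x y, g (x * y) = g x * g y}
  mul_mem' := by
    intro g h hg hh x y
    simp only [LinearEquiv.mul_apply]
    rw [hh, hg]
  one_mem' := fun _ _ => rfl
  inv_mem' := by
    intro g hg x y
    apply g.injective
    have h : ∀ z, g (g⁻¹ z) = z := g.apply_symm_apply
    rw [hg, h, h, h]

theorem Aut.map_mul (g : Aut F A) (x y : A) : g.1 (x * y) = g.1 x * g.1 y := g.2 x y

theorem Aut.map_eigen (g : Aut F A) (a : A) (μ : F) :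
    (eigen F a μ).map (g.1 : A →ₗ[F] A) = eigen F (g.1 a) μ := by
  ext v
  simp only [Submodule.mem_map, LinearEquiv.coe_coe, mem_eigen]
  constructor
  · rintro ⟨u, hu, rfl⟩
    rw [← Aut.map_mul, hu, map_smul]
  · intro hv
    refine ⟨g.1.symm v, g.1.injective ?_, g.1.apply_symm_apply v⟩
    rw [Aut.map_mul, map_smul, g.1.apply_symm_apply, hv]

theorem Aut.map_eigenSum (g : Aut F A) (α β : F) (a : A) (S : Set MonsterLabel) :
    (eigenSum α β a S).map (g.1 : A →ₗ[F] A) = eigenSum α β (g.1 a) S := by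
  simp only [eigenSum, Submodule.map_iSup, Aut.map_eigen]

theorem IsAxis.map {α β : F} {a : A} (h : IsAxis α β a) (g : Aut F A) : IsAxis α β (g.1 a) where
  idem := by rw [← Aut.map_mul, h.idem]
  semisimple := by
    rw [← Aut.map_eigenSum, h.semisimple, Submodule.map_top, LinearMap.range_eq_top]
    exact g.1.surjective
  fusion := by
    intro i j x hx y hy
    rw [← Aut.map_eigen] at hx hy
    obtain ⟨u, hu, rfl⟩ := hx
    obtain ⟨v, hv, rfl⟩ := hy
    rw [← Aut.map_eigenSum]
    exact ⟨u * v, h.fusion i j u hu v hv, Aut.map_mul g u v⟩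
  primitive := by
    rw [← Aut.map_eigen, h.primitive, Submodule.map_span, Set.image_singleton]
    rfl

theorem IsAxis.induction {α β : F} {a : A} (h : IsAxis α β a) {p : A → Prop}
    (mem : ∀ i : MonsterLabel, ∀ v ∈ eigen F a (i.value α β), p v) (zero : p 0)
    (add : ∀ v w, p v → p w → p (v + w)) (v : A) : p v := by
  have hv : v ∈ ⨆ i : MonsterLabel, eigen F a (i.value α β) := by
    have h1 := h.semisimple
    simp only [eigenSum, Set.mem_univ, iSup_pos] at h1
    rw [h1]
    trivial
  exact Submodule.iSup_induction _ (motive := p) hv mem zero add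

/-- For an axis `a` there is exactly one automorphism of `A` that is the identity on the
eigenspaces of `a` for `1, 0, α` and minus the identity on the eigenspace for `β`. -/
theorem existsUnique_miyamoto {α β : F} (hp : IsMonsterPair α β) {a : A} (h : IsAxis α β a) :
    ∃! t : Aut F A, ∀ i : MonsterLabel, ∀ v ∈ eigen F a (i.value α β), t.1 v = i.grade • v := by
  obtain ⟨h1, h2, h3, h4, h5⟩ := hp
  have hD : β * (β - 1) * (β - α) ≠ 0 :=
    mul_ne_zero (mul_ne_zero h3 (sub_ne_zero.2 h4)) (sub_ne_zero.2 h5.symm)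
  let m : A →ₗ[F] A := LinearMap.mulLeft F a
  let L : A →ₗ[F] A := LinearMap.id - (2 / (β * (β - 1) * (β - α))) •
    (m ∘ₗ (m - LinearMap.id) ∘ₗ (m - α • LinearMap.id))
  have hL : ∀ i : MonsterLabel, ∀ v ∈ eigen F a (i.value α β), L v = i.grade • v := by
    intro i v hv
    rw [mem_eigen] at hv
    have e : L v = (1 - (2 / (β * (β - 1) * (β - α))) *
        (i.value α β * (i.value α β - 1) * (i.value α β - α))) • v := by
      simp only [L, m, LinearMap.sub_apply, LinearMap.smul_apply, LinearMap.comp_apply,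
        LinearMap.id_apply, LinearMap.mulLeft_apply, mul_sub, mul_smul_comm, hv]
      module
    rw [e]
    cases i
    · simp [MonsterLabel.value, MonsterLabel.grade]
    · simp [MonsterLabel.value, MonsterLabel.grade]
    · simp [MonsterLabel.value, MonsterLabel.grade]
    · simp only [MonsterLabel.value, MonsterLabel.grade]
      rw [div_mul_cancel₀ _ hD]
      norm_num
  have hLL : ∀ v, L (L v) = v := by
    refine h.induction (fun i v hv => ?_) (by simp) (fun v w hv hw => by rw [map_add, map_add, hv, hw])
    rw [hL i v hv, Units.smul_def, map_zsmul, hL i v hv, Units.smul_def, smul_smul]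
    cases i <;> simp [MonsterLabel.grade]
  have hS : ∀ (S : Set MonsterLabel) (u : ℤˣ), (∀ k ∈ S, k.grade = u) →
      ∀ v ∈ eigenSum α β a S, L v = u • v := by
    intro S u hu v hv
    refine Submodule.iSup_induction _ (motive := fun v => L v = u • v) hv (fun k w hw => ?_)
      (by simp) (fun x y hx hy => by rw [map_add, hx, hy, smul_add])
    by_cases hk : k ∈ S
    · simp only [hk, iSup_pos] at hw
      rw [hL k w hw, hu k hk]
    · simp only [hk, iSup_neg, not_false_eq_true, Submodule.mem_bot] at hw
      simp [hw]
  have hmul : ∀ v w, L (v * w) = L v * L w := by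
    intro v w
    revert w
    refine h.induction (p := fun v => ∀ w, L (v * w) = L v * L w) (fun i v hv w => ?_) (by simp)
      (fun v v' hv hv' w => by rw [add_mul, map_add, map_add, hv, hv', add_mul]) v
    refine h.induction (p := fun w => L (v * w) = L v * L w) (fun j w hw => ?_) (by simp)
      (fun w w' hw hw' => by rw [mul_add, map_add, map_add, hw, hw', mul_add]) w
    rw [hL i v hv, hL j w hw, hS _ _ (MonsterLabel.grade_star i j) _ (h.fusion i j v hv w hw)]
    simp only [Units.smul_def, Units.val_mul, smul_mul_assoc, mul_smul_comm, smul_smul]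
    rw [mul_comm]
  refine ⟨⟨LinearEquiv.ofLinearMap L L (LinearMap.ext hLL) (LinearMap.ext hLL), hmul⟩, hL, ?_⟩
  intro t ht
  apply Subtype.ext
  apply LinearEquiv.ext
  refine h.induction (fun i v hv => (ht i v hv).trans (hL i v hv).symm) (by simp)
    (fun v w hv hw => by rw [map_add, map_add, hv, hw])

/-- The Miyamoto involution of an axis. -/
noncomputable def miyamoto {α β : F} (hp : IsMonsterPair α β) {a : A} (h : IsAxis α β a) :
    Aut F A :=
  (existsUnique_miyamoto hp h).choose

theorem miyamoto_apply {α β : F} (hp : IsMonsterPair α β) {a : A} (h : IsAxis α β a)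
    (i : MonsterLabel) (v : A) (hv : v ∈ eigen F a (i.value α β)) :
    (miyamoto hp h).1 v = i.grade • v :=
  (existsUnique_miyamoto hp h).choose_spec.1 i v hv

theorem eq_miyamoto {α β : F} (hp : IsMonsterPair α β) {a : A} (h : IsAxis α β a) {t : Aut F A}
    (ht : ∀ i : MonsterLabel, ∀ v ∈ eigen F a (i.value α β), t.1 v = i.grade • v) :
    t = miyamoto hp h :=
  (existsUnique_miyamoto hp h).choose_spec.2 t ht

theorem miyamoto_mul_self {α β : F} (hp : IsMonsterPair α β) {a : A} (h : IsAxis α β a) :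
    miyamoto hp h * miyamoto hp h = 1 := by
  apply Subtype.ext
  apply LinearEquiv.ext
  refine h.induction (fun i v hv => ?_) (by simp) (fun v w hv hw => by rw [map_add, map_add, hv, hw])
  change (miyamoto hp h).1 ((miyamoto hp h).1 v) = v
  rw [miyamoto_apply hp h i v hv, Units.smul_def, map_zsmul, miyamoto_apply hp h i v hv,
    Units.smul_def, smul_smul]
  cases i <;> simp [MonsterLabel.grade]

theorem miyamoto_apply_self {α β : F} (hp : IsMonsterPair α β) {a : A} (h : IsAxis α β a) :
    (miyamoto hp h).1 a = a := by
  have ha : a ∈ eigen F a (MonsterLabel.one.value α β) := by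
    simp [mem_eigen, MonsterLabel.value, h.idem]
  simpa [MonsterLabel.grade] using miyamoto_apply hp h .one a ha

theorem miyamoto_map {α β : F} (hp : IsMonsterPair α β) {a : A} (h : IsAxis α β a) (g : Aut F A) :
    miyamoto hp (h.map g) = g * miyamoto hp h * g⁻¹ := by
  symm
  apply eq_miyamoto
  intro i v hv
  rw [← Aut.map_eigen] at hv
  obtain ⟨u, hu, rfl⟩ := hv
  change g.1 ((miyamoto hp h).1 (g.1.symm (g.1 u))) = i.grade • g.1 u
  rw [g.1.symm_apply_apply, miyamoto_apply hp h i u hu, Units.smul_def, map_zsmul, Units.smul_def]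

variable (A) in
/-- The type of all primitive `M(α, β)`-axes of `A`. -/
def Axes (α β : F) : Type _ := {a : A // IsAxis α β a}

instance (α β : F) : MulAction (Aut F A) (Axes A α β) where
  smul g x := ⟨g.1 x.1, x.2.map g⟩
  one_smul _ := rfl
  mul_smul _ _ _ := rfl

variable (A) in
/-- The `C₂`-axet of all `M(α, β)`-axes of `A`, with `Aut(A)` acting: the generator of `C₂` is sent
by `τ x` to the Miyamoto involution of `x`. -/
noncomputable def axetOfAxes {α β : F} (hp : IsMonsterPair α β) :
    Axet ℤˣ (Aut F A) (Axes A α β) where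
  τ x s := if s = 1 then 1 else miyamoto hp x.2
  fixes x s := by
    split_ifs
    · exact one_smul _ x
    · exact Subtype.ext (miyamoto_apply_self hp x.2)
  map_mul x s s' := by
    rcases Int.units_eq_one_or s with rfl | rfl <;> rcases Int.units_eq_one_or s' with rfl | rfl <;>
      simp [miyamoto_mul_self]
  equivariant g x s := by
    split_ifs
    · simp
    · exact miyamoto_map hp x.2 g

/-- The axet `⟨X⟩` of an axial algebra `(A, X)`: the closure of `X` in the axet of all axes. -/
noncomputable def generatedAxet {α β : F} (hp : IsMonsterPair α β) (X : Set A) :=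
  (axetOfAxes A hp).restrict ((axetOfAxes A hp).closure {x | x.1 ∈ X})
    ((axetOfAxes A hp).isClosed_closure _)

end Algebra

/-- Isomorphism of (non-unital, non-associative) `F`-algebras. -/
def AlgIso (F A B : Type*) [Field F] [NonUnitalNonAssocRing A] [Module F A]
    [NonUnitalNonAssocRing B] [Module F B] : Prop :=
  ∃ e : A ≃ₗ[F] B, ∀ x y, e (x * y) = e x * e y

/-! ## Algebras given by multiplication tables -/

/-- The algebra with basis `(e i)` indexed by `ι` in which `e i * e j = ∑ k, c i j k • e k`. -/
def TableAlgebra {F ι : Type*} (_c : ι → ι → ι → F) : Type _ := ι → F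

namespace TableAlgebra

variable {F ι : Type*} [Field F] [Fintype ι] {c : ι → ι → ι → F}

instance : AddCommGroup (TableAlgebra c) := inferInstanceAs (AddCommGroup (ι → F))

instance : Module F (TableAlgebra c) := inferInstanceAs (Module F (ι → F))

instance : Mul (TableAlgebra c) where
  mul x y := fun k => ∑ i, ∑ j, x i * y j * c i j k

theorem mul_apply (x y : TableAlgebra c) (k : ι) :
    (x * y) k = ∑ i, ∑ j, x i * y j * c i j k := rfl

theorem add_apply (x y : TableAlgebra c) (k : ι) : (x + y) k = x k + y k := rfl

theorem smul_apply (r : F) (x : TableAlgebra c) (k : ι) : (r • x) k = r * x k := rfl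

theorem zero_apply (k : ι) : (0 : TableAlgebra c) k = 0 := rfl

instance : NonUnitalNonAssocRing (TableAlgebra c) where
  left_distrib x y z := by
    funext k
    simp only [mul_apply, add_apply, mul_add, add_mul, Finset.sum_add_distrib]
  right_distrib x y z := by
    funext k
    simp only [mul_apply, add_apply, add_mul, Finset.sum_add_distrib]
  zero_mul x := by
    funext k
    simp only [mul_apply, zero_apply, zero_mul, Finset.sum_const_zero]
  mul_zero x := by
    funext k
    simp only [mul_apply, zero_apply, zero_mul, mul_zero, Finset.sum_const_zero]

instance : SMulCommClass F (TableAlgebra c) (TableAlgebra c) where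
  smul_comm r x y := by
    funext k
    simp only [smul_eq_mul, smul_apply, mul_apply, Finset.mul_sum]
    refine Finset.sum_congr rfl fun i _ => Finset.sum_congr rfl fun j _ => ?_
    ring

instance : IsScalarTower F (TableAlgebra c) (TableAlgebra c) where
  smul_assoc r x y := by
    funext k
    simp only [smul_eq_mul, smul_apply, mul_apply, Finset.mul_sum]
    refine Finset.sum_congr rfl fun i _ => Finset.sum_congr rfl fun j _ => ?_
    ring

/-- The basis vector `e i`. -/
def e (c : ι → ι → ι → F) [DecidableEq ι] (i : ι) : TableAlgebra c := Pi.single i 1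

theorem e_mul_e [DecidableEq ι] (i j : ι) : (e c i * e c j : TableAlgebra c) = c i j := by
  funext k
  rw [mul_apply]
  simp [e, Pi.single_apply]

end TableAlgebra

section Examples

variable (F : Type*) [Field F]

/-- The algebra `3C(η)`: basis `x, y, z` of idempotents, the product of two different ones being
`(η / 2) • (first + second - third)`. -/
abbrev ThreeC (η : F) : Type _ :=
  TableAlgebra (F := F) (ι := Fin 3)
    ![![![1, 0, 0], ![η / 2, η / 2, -(η / 2)], ![η / 2, -(η / 2), η / 2]],
      ![![η / 2, η / 2, -(η / 2)], ![0, 1, 0], ![-(η / 2), η / 2, η / 2]],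
      ![![η / 2, -(η / 2), η / 2], ![-(η / 2), η / 2, η / 2], ![0, 0, 1]]]

open Classical in
/-- The algebra underlying `3C(α, 1 - α)`: it is `3C(α)` for `α ≠ -1`, and `3C(2)` for `α = -1`. -/
noncomputable abbrev ThreeCSkew (α : F) : Type _ := ThreeC F (if α = -1 then 2 else α)

/-- The algebra underlying `Q₂(1/3, 2/3)`, that is `Q₂(1/3)`, with basis `s₁, s₂, d₁, d₂`
(characteristic not `2` or `3`). -/
abbrev QTwo : Type _ :=
  TableAlgebra (F := F) (ι := Fin 4)
    ![![![1, 0, 0, 0], ![0, 0, 0, 0], ![1 / 3, 0, 1 / 6, -(1 / 6)], ![1 / 3, 0, -(1 / 6), 1 / 6]],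
      ![![0, 0, 0, 0], ![0, 1, 0, 0], ![0, 1 / 3, 1 / 6, -(1 / 6)], ![0, 1 / 3, -(1 / 6), 1 / 6]],
      ![![1 / 3, 0, 1 / 6, -(1 / 6)], ![0, 1 / 3, 1 / 6, -(1 / 6)], ![0, 0, 1, 0],
        ![-(1 / 3), -(1 / 3), 1 / 3, 1 / 3]],
      ![![1 / 3, 0, -(1 / 6), 1 / 6], ![0, 1 / 3, -(1 / 6), 1 / 6],
        ![-(1 / 3), -(1 / 3), 1 / 3, 1 / 3], ![0, 0, 0, 1]]]

/-- The algebra `Q₂(1/3)ˣ ⊕ ⟨𝟙⟩` (characteristic `5`), with basis `x, y, z, 𝟙`. -/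
abbrev QTwoQuotientUnit : Type _ :=
  TableAlgebra (F := F) (ι := Fin 4)
    ![![![1, 0, 0, 0], ![0, 0, 0, 0], ![3, 1, 2, 0], ![1, 0, 0, 0]],
      ![![0, 0, 0, 0], ![0, 1, 0, 0], ![1, 3, 2, 0], ![0, 1, 0, 0]],
      ![![3, 1, 2, 0], ![1, 3, 2, 0], ![0, 0, 1, 0], ![0, 0, 1, 0]],
      ![![1, 0, 0, 0], ![0, 1, 0, 0], ![0, 0, 1, 0], ![0, 0, 0, 1]]]

end Examples

end SkewAxial

/-! One generator, `b`, has a Miyamoto involution fixing both generators, hence trivial. So `b` has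
no `β`-eigenvectors: it is an axis of Jordan type `α`, and negating its `α`-eigenspace gives a
second automorphism `σ`. The involution `τ` of the other generator `a` moves `b`. Multiplication by
`b` is governed by `σ`, multiplication by `a` by `τ`, and playing the two against each other
determines the algebra.

The `τ`-fixed element `b + τ b` has no `β`-part at `a`, so `ad a (ad a - α)` sends it to a multiple
of `a`. Expanding this expresses `a * σ a`, which `σ` fixes; invariance of the expression yields `β
(β - α) (τ b - σ (τ b)) = K (a - σ a)` for some scalar `K` (`relation`).

If `K = 0`, then `σ` fixes `τ b` and `b * τ b = 0`. The elements `a, b, τ b, σ a` then have a closed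
multiplication table (`qTwo_table`), and the fusion rules `0 ⋆ 0` at `b` and `α ⋆ α` at `a` force `α
= 1/3`, `β = 2/3` (`qTwo_scalars`). The change of basis to `s₁, s₂, d₁, d₂` has determinant `±5`,
which is why characteristic `5` is separate.

If `K ≠ 0`, then `σ a` differs from `a` by a multiple of `τ b - σ (τ b)`. The rule `0 ⋆ 0` at `b`
and idempotence of `τ (σ a)` force `α + β = 1` and make `b, τ b, σ (τ b)` multiply as in `3C(α)`
(`threeC_scalars`). For `α ≠ -1` that algebra has an identity and `a` is `1 - σ (τ b)`; for `α = -1`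
the three elements sum to zero, and with `a` they generate `3C(2)`. -/

namespace SkewAxial

/-! ### The two-involution setting. -/

/-- A pair of idempotents `a`, `b` generating `A`, where `b` behaves like a primitive axis of Jordan
type `α` with involution `σ`, and `a` like a primitive `M(α, β)`-axis with involution `τ` which
moves `b`. -/
structure SkewPair {F A : Type*} [Field F] [NonUnitalNonAssocCommRing A] [Module F A]
    [SMulCommClass F A A] [IsScalarTower F A A]
    (α β : F) (a b : A) (σ τ : A →ₗ[F] A) : Prop where
  two_ne : (2 : F) ≠ 0
  pair : IsMonsterPair α β
  idem_a : a * a = a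
  idem_b : b * b = b
  map_σ : ∀ x y, σ (x * y) = σ x * σ y
  map_τ : ∀ x y, τ (x * y) = τ x * τ y
  σσ : ∀ x, σ (σ x) = x
  ττ : ∀ x, τ (τ x) = x
  σ_b : σ b = b
  τ_a : τ a = a
  τ_b : τ b ≠ b
  mul_sub_τ : ∀ x, a * (x - τ x) = β • (x - τ x)
  τ_eq_neg : ∀ x, a * x = β • x → τ x = -x
  mul_b : ∀ x, ∃ φ : F, b * x = φ • b + (α / 2) • (x - σ x)
  mul_sub_σ : ∀ x, b * (x - σ x) = α • (x - σ x)
  zero_b : ∀ x, b * x = 0 → b * (x * x) = 0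
  proj_a : ∀ x, τ x = x → ∃ μ : F, a * (a * x) - α • (a * x) = ((1 - α) * μ) • a
  alpha_a : ∀ x, a * x = α • x → ∃ ν : F, a * (x * x) = ν • a
  primitive_a : ∀ x, a * x = x → ∃ ν : F, x = ν • a
  generates : NonUnitalAlgebra.adjoin F {a, b} = ⊤

/-! ### Recognizing an algebra from a multiplication table. -/

section

variable {F A : Type*} [Field F] [NonUnitalNonAssocCommRing A] [Module F A]
  [SMulCommClass F A A] [IsScalarTower F A A]

/-- The table makes the span of `v` a subalgebra; it contains the generators, so it is everything
and `v` is a basis. -/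
theorem algIso_of_table {ι : Type*} [Fintype ι] [DecidableEq ι] (c : ι → ι → ι → F) (v : ι → A)
    (hv : LinearIndependent F v) (hmul : ∀ i j, v i * v j = ∑ k, c i j k • v k) (s : Set A)
    (hs : NonUnitalAlgebra.adjoin F s = ⊤) (hsv : s ⊆ Submodule.span F (Set.range v)) :
    AlgIso F A (TableAlgebra c) := by
  have hmem : ∀ x ∈ Submodule.span F (Set.range v), ∀ y ∈ Submodule.span F (Set.range v),
      x * y ∈ Submodule.span F (Set.range v) := by
    intro x hx y hy
    induction hx, hy using Submodule.span_induction₂ with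
    | mem_mem x y hx hy =>
      obtain ⟨i, rfl⟩ := hx
      obtain ⟨j, rfl⟩ := hy
      rw [hmul]
      exact Submodule.sum_mem _ fun k _ =>
        Submodule.smul_mem _ _ (Submodule.subset_span ⟨k, rfl⟩)
    | zero_left => simp
    | zero_right => simp
    | add_left x y z _ _ _ hx hy => rw [add_mul]; exact add_mem hx hy
    | add_right x y z _ _ _ hx hy => rw [mul_add]; exact add_mem hx hy
    | smul_left r x y _ _ h => rw [smul_mul_assoc]; exact Submodule.smul_mem _ _ h
    | smul_right r x y _ _ h => rw [mul_smul_comm]; exact Submodule.smul_mem _ _ h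
  let S : NonUnitalSubalgebra F A :=
    { Submodule.span F (Set.range v) with mul_mem' := fun {x y} hx hy => hmem x hx y hy }
  have hS : S = ⊤ := by
    rw [eq_top_iff, ← hs]
    exact NonUnitalAlgebra.adjoin_le hsv
  have htop : ⊤ ≤ Submodule.span F (Set.range v) := fun x _ => by
    have : x ∈ S := hS ▸ trivial
    exact this
  let B : Module.Basis ι F A := Module.Basis.mk hv htop
  have hB : ∀ f : ι → F, B.equivFun.symm f = ∑ i, f i • v i := fun f => by
    simp [B, Module.Basis.equivFun_symm_apply]
  let E : TableAlgebra c ≃ₗ[F] A := B.equivFun.symm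
  have hE : ∀ f : TableAlgebra c, E f = ∑ i, f i • v i := hB
  have hEm : ∀ f g : TableAlgebra c, E (f * g) = E f * E g := by
    intro f g
    simp only [hE, Finset.sum_mul_sum, TableAlgebra.mul_apply, smul_mul_smul_comm, hmul,
      Finset.sum_smul, Finset.smul_sum, smul_smul]
    rw [Finset.sum_comm]
    exact Finset.sum_congr rfl fun i _ => Finset.sum_comm
  refine ⟨E.symm, fun x y => E.injective ?_⟩
  rw [hEm]
  simp

end

/-! ### Basic products and the relation between `a - σ a` and `τ b - σ (τ b)`. -/

namespace SkewPair

variable {F A : Type*} [Field F] [NonUnitalNonAssocCommRing A] [Module F A]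
  [SMulCommClass F A A] [IsScalarTower F A A] {α β : F} {a b : A} {σ τ : A →ₗ[F] A}

theorem b_ne_zero (h : SkewPair α β a b σ τ) : b ≠ 0 := by
  rintro rfl
  exact h.τ_b (map_zero τ)

theorem smul_b (h : SkewPair α β a b σ τ) {p : F} (hp : p • b = 0) : p = 0 :=
  (smul_eq_zero.1 hp).resolve_right h.b_ne_zero

theorem half_smul (h : SkewPair α β a b σ τ) {x : A} (hx : (2 : F) • x = 0) : x = 0 :=
  (smul_eq_zero.1 hx).resolve_left h.two_ne

theorem b_sub_ne_zero (h : SkewPair α β a b σ τ) : b - τ b ≠ 0 :=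
  sub_ne_zero.2 h.τ_b.symm

theorem smul_b_sub (h : SkewPair α β a b σ τ) {p : F} (hp : p • (b - τ b) = 0) : p = 0 :=
  (smul_eq_zero.1 hp).resolve_right h.b_sub_ne_zero

theorem b_add_ne_zero (h : SkewPair α β a b σ τ) : b + τ b ≠ 0 := by
  intro hs
  have hc : τ b = -b := by linear_combination (norm := module) hs
  have h1 : τ b * τ b = τ b := by rw [← h.map_τ, h.idem_b]
  rw [hc, neg_mul_neg, h.idem_b] at h1
  exact h.τ_b (hc.trans h1.symm)

theorem linIndep (h : SkewPair α β a b σ τ) {p q : F} (hpq : p • b + q • τ b = 0) :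
    p = 0 ∧ q = 0 := by
  have h1 := congrArg τ hpq
  rw [map_add, map_smul, map_smul, h.ττ, map_zero] at h1
  have h2 : (p - q) • (b - τ b) = 0 := by linear_combination (norm := module) hpq - h1
  have h3 := sub_eq_zero.1 (h.smul_b_sub h2)
  have h4 : p • (b + τ b) = 0 := by rw [← h3] at hpq; linear_combination (norm := module) hpq
  have h5 := (smul_eq_zero.1 h4).resolve_right h.b_add_ne_zero
  exact ⟨h5, h3 ▸ h5⟩

/-- The products of `b` with `a` and `τ b`; the scalars are the projections to `b`. -/
theorem exists_mul (h : SkewPair α β a b σ τ) : ∃ l φ : F,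
    b * a = l • b + (α / 2) • (a - σ a) ∧ b * τ b = φ • b + (α / 2) • (τ b - σ (τ b)) := by
  obtain ⟨l, hl⟩ := h.mul_b a
  obtain ⟨φ, hφ⟩ := h.mul_b (τ b)
  exact ⟨l, φ, hl, hφ⟩

theorem τ_mul_ba (h : SkewPair α β a b σ τ) {l : F} (hl : b * a = l • b + (α / 2) • (a - σ a)) :
    τ b * a = l • τ b + (α / 2) • (a - τ (σ a)) := by
  have := congrArg τ hl
  simpa only [h.map_τ, map_add, map_sub, map_smul, h.τ_a] using this

theorem σ_mul_ba (h : SkewPair α β a b σ τ) {l : F} (hl : b * a = l • b + (α / 2) • (a - σ a)) :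
    b * σ a = l • b + (α / 2) • (σ a - a) := by
  have := congrArg σ hl
  simpa only [h.map_σ, map_add, map_sub, map_smul, h.σ_b, h.σσ] using this

theorem a_mul_sub (h : SkewPair α β a b σ τ) : a * b - a * τ b = β • (b - τ b) := by
  rw [← h.mul_sub_τ, mul_sub]

/-- The element `b - τ b` is a `β`-eigenvector of `a`. Writing both `a * b` and `a * τ b` by means
of `σ a` and `τ (σ a)` turns this into a formula for the difference of the latter. -/
theorem τσ_a (h : SkewPair α β a b σ τ) {l : F} (hl : b * a = l • b + (α / 2) • (a - σ a)) :
    τ (σ a) = σ a + (2 * (β - l) / α) • (b - τ b) := by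
  have h1 := h.τ_mul_ba hl
  have h2 := h.a_mul_sub
  rw [mul_comm a b, mul_comm a, h1, hl] at h2
  have hα := h.pair.alpha_ne_zero
  have h20 := h.two_ne
  have h3 : (2 / α) • ((α / 2) • τ (σ a) - (α / 2) • σ a - (β - l) • (b - τ b)) = 0 := by
    rw [smul_eq_zero]; right
    linear_combination (norm := module) h2
  have e1 : 2 / α * (α / 2) = 1 := by field_simp
  have e2 : 2 / α * (β - l) = 2 * (β - l) / α := by ring
  simp only [smul_sub, smul_smul, e1, e2] at h3
  linear_combination (norm := module) h3

/-- Otherwise `τσ_a` gives `l = β`, so `b` is itself a `β`-eigenvector of `a` and `τ b = -b`,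
contradicting `b_add_ne_zero`. -/
theorem σ_a_ne (h : SkewPair α β a b σ τ) : σ a ≠ a := by
  intro hσ
  obtain ⟨l, φ, hl, -⟩ := h.exists_mul
  have h1 := h.τσ_a hl
  rw [hσ, h.τ_a] at h1
  have h2 : (2 * (β - l) / α) • (b - τ b) = 0 := by linear_combination (norm := module) -h1
  have h3 := h.smul_b_sub h2
  have hα := h.pair.alpha_ne_zero
  have h20 := h.two_ne
  have h4 : l = β := by
    rw [div_eq_zero_iff, mul_eq_zero] at h3
    exact (sub_eq_zero.1 ((h3.resolve_right hα).resolve_left h20)).symm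
  rw [hσ, h4, sub_self, smul_zero, add_zero, mul_comm] at hl
  have h5 := h.τ_eq_neg b hl
  exact h.b_add_ne_zero (by rw [h5, add_neg_cancel])

/-- The operator `ad b (ad b - α)` kills the `0`- and `α`-parts of `τ b`, leaving only its
projection to `b`. -/
theorem mul_mul_b (h : SkewPair α β a b σ τ) {φ : F}
    (hφ : b * τ b = φ • b + (α / 2) • (τ b - σ (τ b))) :
    b * (b * τ b) = ((1 - α) * φ) • b + α • (b * τ b) := by
  have h1 := congrArg (b * ·) hφ
  simp only [mul_add, mul_smul_comm, h.mul_sub_σ, h.idem_b] at h1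
  rw [h1, hφ]
  module

/-- If the projection of `τ b` to `A_α(b)` vanishes, then `b * τ b = 0`. -/
theorem mul_eq_zero_of_σ (h : SkewPair α β a b σ τ) (hc : σ (τ b) = τ b) : b * τ b = 0 := by
  obtain ⟨l, φ, -, hφ⟩ := h.exists_mul
  rw [hc, sub_self, smul_zero, add_zero] at hφ
  -- The product is `φ • b`, but it is also fixed by `τ`, which moves `b`; hence `φ = 0`.
  have h1 := congrArg τ hφ
  rw [h.map_τ, map_smul, h.ττ, mul_comm, hφ] at h1
  have h2 : φ • (b - τ b) = 0 := by linear_combination (norm := module) h1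
  rw [hφ, h.smul_b_sub h2, zero_smul]

theorem σ_of_mul_eq_zero (h : SkewPair α β a b σ τ) (hbc : b * τ b = 0) : σ (τ b) = τ b := by
  obtain ⟨l, φ, -, hφ⟩ := h.exists_mul
  have h1 := h.mul_mul_b hφ
  have hα := h.pair.alpha_ne_zero
  rw [hbc, mul_zero, smul_zero, add_zero] at h1
  have h2 := (mul_eq_zero.1 (h.smul_b h1.symm)).resolve_left
    (sub_ne_zero.2 h.pair.alpha_ne_one.symm)
  rw [hbc, h2, zero_smul, zero_add] at hφ
  have h3 := (smul_eq_zero.1 hφ.symm).resolve_left (div_ne_zero hα h.two_ne)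
  exact (sub_eq_zero.1 h3).symm

/-- The product `a * σ a`, and the relation between `b`- and `a`-differences that results from its
`σ`-invariance; `m • a` is the multiple of `a` in `(ad a - α) (a * (b + τ b))`. -/
theorem relation (h : SkewPair α β a b σ τ) {l : F}
    (hl : b * a = l • b + (α / 2) • (a - σ a)) : ∃ m : F,
    a * (a * (b + τ b)) - α • (a * (b + τ b)) = m • a ∧
    (α • (a * σ a) = (l - α) • (l • (b + τ b) - α • σ a - (β - l) • (b - τ b))
      + (α * (l - α) + α - m) • a - (β * (β - l)) • (b - τ b)) ∧
    (β * (β - α)) • (τ b - σ (τ b)) = (m - (2 * α * (l - α) + α)) • (a - σ a) := by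
  have hα := h.pair.alpha_ne_zero
  have h20 := h.two_ne
  -- Being `τ`-fixed, `b + τ b` has only `1`-, `0`- and `α`-parts at `a`, and `ad a (ad a - α)`
  -- kills the last two.
  obtain ⟨m, hμ⟩ : ∃ m : F, a * (a * (b + τ b)) - α • (a * (b + τ b)) = m • a :=
    (h.proj_a (b + τ b) (by rw [map_add, h.ττ, add_comm])).elim fun _ hμ => ⟨_, hμ⟩
  have hw := h.τσ_a hl
  have hκ : α * (2 * (β - l) / α) = 2 * (β - l) := by field_simp
  generalize 2 * (β - l) / α = κ at *
  have ec := h.τ_mul_ba hl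
  rw [hw] at ec
  rw [mul_comm] at hl ec
  have es : a * (b + τ b) = l • (b + τ b) + α • a - α • σ a - (α * κ / 2) • (b - τ b) := by
    rw [mul_add, hl, ec]
    match_scalars <;> field_simp <;> ring
  have ed := h.mul_sub_τ b
  have h1 : α • (a * σ a) = (l - α) • (l • (b + τ b) - α • σ a - (β - l) • (b - τ b))
      + (α * (l - α) + α - m) • a - (β * (β - l)) • (b - τ b) := by
    clear hl ec hw
    generalize b + τ b = s at *
    generalize b - τ b = d at *
    have e2 := congrArg (a * ·) es
    simp only [mul_sub, mul_add, mul_smul_comm, h.idem_a, ed] at e2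
    rw [e2, es] at hμ
    have e3 : α * κ / 2 = β - l := by rw [hκ]; field_simp
    rw [e3] at hμ
    linear_combination (norm := module) -hμ
  refine ⟨m, hμ, h1, ?_⟩
  -- Since `σ` interchanges `a` and `σ a`, it fixes their product, so the right side of `h1` is
  -- `σ`-fixed too.
  have h2 := congrArg σ h1
  simp only [map_add, map_sub, map_smul, h.map_σ, h.σσ, h.σ_b] at h2
  rw [mul_comm (σ a)] at h2
  have h3 := h1.symm.trans h2
  linear_combination (norm := skip) h3
  match_scalars <;> field_simp <;> ring

/-- Idempotence of `τ (σ a)` gives a condition on the scalars. -/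
theorem scalar_relation (h : SkewPair α β a b σ τ) {l κ : F}
    (hl : b * a = l • b + (α / 2) • (a - σ a)) (hκ : α * κ = 2 * (β - l))
    (hw : τ (σ a) = σ a + κ • (b - τ b)) : κ = 0 ∨ 4 * l - 2 * β + κ = 1 := by
  have h20 := h.two_ne
  have h1 := h.σ_mul_ba hl
  have h2 := congrArg τ h1
  simp only [h.map_τ, map_add, map_sub, map_smul, h.τ_a] at h2
  have h3 : τ (σ a) * τ (σ a) = τ (σ a) := by rw [← h.map_τ, ← h.map_σ, h.idem_a]
  have h4 : σ a * σ a = σ a := by rw [← h.map_σ, h.idem_a]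
  have hcc : τ b * τ b = τ b := by rw [← h.map_τ, h.idem_b]
  rw [hw] at h2 h3
  simp only [mul_add, add_mul, mul_sub, sub_mul, mul_smul_comm, smul_mul_assoc, h4, hcc,
    h.idem_b, mul_comm (σ a), mul_comm (τ b) b, h1] at h2 h3
  have h5 : τ b * σ a = l • τ b + (α / 2) • (σ a + κ • (b - τ b) - a)
      - κ • (b * τ b - τ b) := by linear_combination (norm := module) h2
  rw [h5] at h3
  have e3 : α / 2 * κ = β - l := by
    field_simp
    linear_combination hκ
  -- The terms in `b * τ b` cancel, and a multiple of `b - τ b` remains.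
  have h6 : (κ * (4 * l - 2 * β + κ - 1)) • (b - τ b) = 0 := by
    linear_combination (norm := skip) h3
    simp only [smul_add, smul_sub, smul_smul]
    rw [e3]
    module
  rcases mul_eq_zero.1 (h.smul_b_sub h6) with h7 | h7
  · exact Or.inl h7
  · exact Or.inr (sub_eq_zero.1 h7)

/-! ### The case where `σ a` is `a` minus a multiple of `τ b - σ (τ b)`. -/

/-- The element `a - k • τ b` is fixed by `σ`, so its product with `b` is a multiple of `b`.
Applying `τ` and using that `b - τ b` is a `β`-eigenvector of `a` shows the multiple is `β`. -/
theorem mul_b_of_σ_a (h : SkewPair α β a b σ τ) {k φ l : F}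
    (hk : σ a = a - k • (τ b - σ (τ b)))
    (hl : b * a = l • b + (α / 2) • (a - σ a))
    (hφ : b * τ b = φ • b + (α / 2) • (τ b - σ (τ b))) :
    β = l - k * φ ∧ a * b = β • b + k • (b * τ b) ∧ a * τ b = β • τ b + k • (b * τ b) := by
  have h1 : a * b = (l - k * φ) • b + k • (b * τ b) := by
    rw [mul_comm, hl, hk, hφ]
    module
  have h2 := congrArg τ h1
  simp only [h.map_τ, map_add, map_smul, h.τ_a, h.ττ, mul_comm (τ b) b] at h2
  have h3 := h.a_mul_sub
  have h4 : β = l - k * φ := by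
    refine sub_eq_zero.1 (h.smul_b_sub ?_)
    rw [h1, h2] at h3
    linear_combination (norm := module) -h3
  exact ⟨h4, h4 ▸ h1, h4 ▸ h2⟩

/-- Squaring a `0`-eigenvector of `b` gives two scalar equations (`p1`, `p2`), and `scalar_relation`
a third; together they leave only `φ = α / 2`, `α + β = 1`, `k = 1`. -/
theorem threeC_scalars (h : SkewPair α β a b σ τ) {k : F}
    (hk : σ a = a - k • (τ b - σ (τ b))) :
    α + β = 1 ∧ σ a = a - (τ b - σ (τ b)) ∧
      b * τ b = (α / 2) • (b + τ b - σ (τ b)) ∧ a * b = β • b + b * τ b := by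
  obtain ⟨l, φ, hl, hφ⟩ := h.exists_mul
  obtain ⟨e1, e2, e3⟩ := h.mul_b_of_σ_a hk hl hφ
  have h20 := h.two_ne
  obtain ⟨hα, hα1, hβ, hβ1, hαβ⟩ := h.pair
  have hbc : b * τ b ≠ 0 := by
    intro h0
    rw [h.σ_of_mul_eq_zero h0, sub_self, smul_zero, sub_zero] at hk
    exact h.σ_a_ne hk
  -- Independence of `b` and `b * τ b`: `τ` fixes the product but moves `b`.
  have hind : ∀ p q : F, p • b + q • (b * τ b) = 0 → p = 0 ∧ q = 0 := by
    intro p q hpq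
    have h1 := congrArg τ hpq
    simp only [map_add, map_smul, h.map_τ, h.ττ, map_zero, mul_comm (τ b) b] at h1
    have h2 : p • (b - τ b) = 0 := by linear_combination (norm := module) hpq - h1
    have h3 := h.smul_b_sub h2
    rw [h3, zero_smul, zero_add] at hpq
    exact ⟨h3, (smul_eq_zero.1 hpq).resolve_right hbc⟩
  have hcc : τ b * τ b = τ b := by rw [← h.map_τ, h.idem_b]
  have hbbc := h.mul_mul_b hφ
  have hk0 : k ≠ 0 := by
    rintro rfl
    rw [zero_smul, sub_zero] at hk
    exact h.σ_a_ne hk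
  -- Subtracting the `b`-part from the `σ`-fixed element `a - k • τ b` leaves a `0`-eigenvector of
  -- `b`.
  have hf := h.zero_b (a - k • τ b - β • b) (by
    rw [mul_sub, mul_sub, mul_comm b a, e2, mul_smul_comm, mul_smul_comm, h.idem_b]
    module)
  have hf2 : (a - k • τ b - β • b) * (a - k • τ b - β • b) =
      a + (k ^ 2 - 2 * k * β) • τ b - β ^ 2 • b - (2 * k ^ 2) • (b * τ b) := by
    simp only [mul_sub, sub_mul, mul_smul_comm, smul_mul_assoc, h.idem_a, h.idem_b, hcc,
      mul_comm b a, mul_comm (τ b), e2, e3]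
    module
  rw [hf2] at hf
  simp only [mul_sub, mul_add, mul_smul_comm, h.idem_b, mul_comm b a, e2, hbbc] at hf
  obtain ⟨p1, p2⟩ := hind (β - β ^ 2 - 2 * k ^ 2 * ((1 - α) * φ))
    (k * (1 + k - 2 * β - 2 * k * α)) (by linear_combination (norm := module) hf)
  have p3 : k * (1 - 2 * α) = 2 * β - 1 := by
    linear_combination (mul_eq_zero.1 p2).resolve_left hk0
  have hφ0 : φ ≠ 0 := by
    rintro rfl
    have : β * (1 - β) = 0 := by linear_combination p1
    rcases mul_eq_zero.1 this with h0 | h0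
    · exact hβ h0
    · exact hβ1 (sub_eq_zero.1 h0).symm
  have hα2 : 1 - 2 * α ≠ 0 := by
    intro h0
    rw [h0, mul_zero] at p3
    apply hαβ
    have : 2 * α = 2 * β := by linear_combination -h0 + p3
    exact mul_left_cancel₀ h20 this
  have hκ : α * (2 * (β - l) / α) = 2 * (β - l) := by field_simp
  -- The alternative `κ = 0` would mean `l = β`, hence `k * φ = 0`.
  have p4 : φ = α / 2 := by
    rcases h.scalar_relation hl hκ (h.τσ_a hl) with h0 | h0
    · rw [h0, mul_zero] at hκ
      have : 2 * (k * φ) = 0 := by linear_combination hκ + 2 * e1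
      simp [h20, hk0, hφ0] at this
    · have q1 : (k * (1 - 2 * α)) * (2 * φ - α) = 0 := by
        generalize 2 * (β - l) / α = κ at *
        linear_combination hκ - α * h0 - (4 * α - 2) * e1 - α * p3
      rcases mul_eq_zero.1 q1 with q | q
      · simp [hk0, hα2] at q
      · rw [eq_div_iff h20]
        linear_combination q
  -- Put `u = β (1 - β)` and `v = α (1 - α)`. Squaring `p3` and eliminating `k` gives `u (1 - 4 v) =
  -- v (1 - 4 u)`, that is `u = v`.
  have p5 : β * (1 - β) = α * (1 - α) := by
    have q0 : β * (1 - β) = k ^ 2 * (1 - α) * α := by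
      have : α / 2 * 2 = α := div_mul_cancel₀ _ h20
      rw [p4] at p1
      linear_combination p1 + k ^ 2 * (1 - α) * this
    linear_combination (1 - 2 * α) ^ 2 * q0 + α * (1 - α) * (k * (1 - 2 * α) + 2 * β - 1) * p3
  have p6 : α + β = 1 := by
    have : (β - α) * (1 - α - β) = 0 := by linear_combination p5
    have := (mul_eq_zero.1 this).resolve_left (sub_ne_zero.2 hαβ.symm)
    linear_combination -this
  have p7 : k = 1 := by
    apply mul_right_cancel₀ hα2
    linear_combination p3 + 2 * p6
  subst p7
  rw [one_smul] at hk e2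
  refine ⟨p6, hk, ?_, e2⟩
  rw [hφ, p4]
  module

/-- No nonzero element of `A₁(a)` annihilates `b`. -/
theorem eq_zero_of_mul_eq (h : SkewPair α β a b σ τ) {n : A} (ha : a * n = n) (hb : b * n = 0) :
    n = 0 := by
  obtain ⟨ν, rfl⟩ := h.primitive_a n ha
  rcases eq_or_ne ν 0 with rfl | hν
  · exact zero_smul _ _
  · rw [mul_smul_comm] at hb
    have h1 := (smul_eq_zero.1 hb).resolve_left hν
    have h2 := congrArg τ h1
    rw [h.map_τ, h.τ_a, map_zero] at h2
    have h3 := h.a_mul_sub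
    rw [mul_comm a, mul_comm a, h1, h2, sub_zero] at h3
    exact absurd (h.smul_b_sub h3.symm) h.pair.beta_ne_zero

/-- Elements multiplying like the basis of `3C(α)` are independent, unless `α = -1`. -/
theorem threeC_indep (h : SkewPair α β a b σ τ) (hα : α ≠ -1) {x : A} (hx : τ x = x)
    (hbc : b * τ b = (α / 2) • (b + τ b - x)) (hbx : b * x = (α / 2) • (b + x - τ b)) :
    LinearIndependent F ![b, τ b, x] := by
  have h20 := h.two_ne
  have hα0 := h.pair.alpha_ne_zero
  have hx' : ∀ p q : F, x ≠ p • b + q • τ b := by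
    intro p q hpq
    have h1 := congrArg τ hpq
    rw [hx, map_add, map_smul, map_smul, h.ττ, hpq] at h1
    have h2 := h.linIndep (p := p - q) (q := q - p) (by linear_combination (norm := module) h1)
    obtain rfl : p = q := sub_eq_zero.1 h2.1
    rw [hpq, mul_add, mul_smul_comm, mul_smul_comm, h.idem_b, hbc, hpq] at hbx
    obtain ⟨h3, h4⟩ := h.linIndep (p := p + p * (α / 2) * (1 - p) - (α / 2) * (1 + p))
      (q := p * (α / 2) * (1 - p) - (α / 2) * (p - 1))
      (by linear_combination (norm := module) hbx)
    have h5 : (α / 2) * ((1 - p) * (1 + p)) = 0 := by linear_combination h4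
    have h6 := (mul_eq_zero.1 h5).resolve_left (div_ne_zero hα0 h20)
    have h7 : α / 2 * 2 = α := div_mul_cancel₀ _ h20
    rcases mul_eq_zero.1 h6 with h8 | h8
    · have : p = 1 := by linear_combination -h8
      subst this
      exact h.pair.alpha_ne_one (by linear_combination -h3 - h7)
    · have : p = -1 := by linear_combination h8
      subst this
      exact hα (by linear_combination -h3 - h7)
  rw [Fintype.linearIndependent_iff]
  intro f hf
  simp only [Fin.sum_univ_three, Matrix.cons_val_zero, Matrix.cons_val_one, Matrix.cons_val] at hf
  have h2 : f 2 = 0 := by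
    by_contra h0
    refine hx' (-((f 2)⁻¹ * f 0)) (-((f 2)⁻¹ * f 1)) ?_
    have h1 := congrArg ((f 2)⁻¹ • ·) hf
    simp only [smul_add, smul_smul, inv_mul_cancel₀ h0, smul_zero, one_smul] at h1
    linear_combination (norm := module) h1
  rw [h2, zero_smul, add_zero] at hf
  obtain ⟨h0, h1⟩ := h.linIndep hf
  intro i
  fin_cases i
  exacts [h0, h1, h2]

/-- Here `b, τ b` and `x = σ (τ b)` satisfy the `3C(α)` table and `a * x = 0`; what remains is to
locate `a`. In both cases `eq_zero_of_mul_eq`, applied to a `1`-eigenvector of `a`, supplies the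
missing linear relation. -/
theorem algIso_threeC (h : SkewPair α β a b σ τ) {k : F}
    (hk : σ a = a - k • (τ b - σ (τ b))) : AlgIso F A (ThreeCSkew F α) := by
  obtain ⟨hαβ, hσ, hbc, hab⟩ := h.threeC_scalars hk
  have h20 := h.two_ne
  have hα0 := h.pair.alpha_ne_zero
  have hcc : τ b * τ b = τ b := by rw [← h.map_τ, h.idem_b]
  obtain ⟨x, hx⟩ : ∃ x, σ (τ b) = x := ⟨_, rfl⟩
  have hxx : x * x = x := by rw [← hx, ← h.map_σ, hcc]
  have hσx : σ x = τ b := by rw [← hx, h.σσ]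
  rw [hx] at hσ hbc
  have hτx : τ x = x := by
    have h1 := congrArg τ hbc
    rw [h.map_τ, h.ττ, mul_comm, hbc] at h1
    simp only [map_add, map_sub, map_smul, h.ττ] at h1
    have h2 : (α / 2) • (τ x - x) = 0 := by linear_combination (norm := module) h1
    exact sub_eq_zero.1 ((smul_eq_zero.1 h2).resolve_left (div_ne_zero hα0 h20))
  have hbx : b * x = (α / 2) • (b + x - τ b) := by
    have h1 := congrArg σ hbc
    simpa only [h.map_σ, map_add, map_sub, map_smul, h.σ_b, hx, hσx] using h1
  have hcx : τ b * x = (α / 2) • (τ b + x - b) := by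
    have h1 := congrArg τ hbx
    simpa only [h.map_τ, map_add, map_sub, map_smul, h.ττ, hτx] using h1
  have hβ : β = 1 - α := by linear_combination hαβ
  have hac : a * τ b = β • τ b + b * τ b := by
    have h1 := congrArg τ hab
    simpa only [h.map_τ, map_add, map_smul, h.ττ, h.τ_a, mul_comm (τ b) b] using h1
  have : NeZero (2 : F) := ⟨h20⟩
  have e2 : α / 2 + α / 2 = α := add_halves α
  have E : ∀ y : A, (α / 2) • y + (α / 2) • y = α • y := fun y => by rw [← add_smul, e2]
  have hax : a * x = 0 := by
    have h1 := congrArg σ hac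
    simp only [h.map_σ, map_add, map_smul, hσ, hx, h.σ_b, hbx, sub_mul, hcx, hxx] at h1
    rw [hβ] at h1
    linear_combination (norm := module) h1 + E x
  by_cases hα1 : α = -1
  · subst hα1
    -- In `3C(-1)` the sum of the basis annihilates each basis element; it is also a `1`-eigenvector
    -- of `a`, so here it vanishes.
    have hr : b + τ b + x = 0 := by
      have hhalf : (-1 / 2 : F) + -1 / 2 = -1 := add_halves _
      apply h.eq_zero_of_mul_eq
      · rw [mul_add, mul_add, hab, hac, hax, hbc, hβ]
        have e3 : (1 - -1 : F) = 1 - (-1 / 2 + -1 / 2) := by rw [hhalf]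
        have : (-1 / 2 : F) • (b + τ b - x) + (-1 / 2 : F) • (b + τ b - x) = -(b + τ b - x) := by
          rw [← add_smul, hhalf]; module
        linear_combination (norm := module) this
      · rw [mul_add, mul_add, h.idem_b, hbx, hbc]
        have : (-1 / 2 : F) • b + (-1 / 2 : F) • b = -b := by
          rw [← add_smul, hhalf]; module
        linear_combination (norm := module) this
    have hx1 : x = -b - τ b := by linear_combination (norm := module) hr
    have hbc' : b * τ b = -b - τ b := by
      rw [hbc, hx1]
      match_scalars <;> field_simp <;> ring
    unfold ThreeCSkew
    rw [if_pos rfl]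
    have hab' : a * b = b - τ b := by rw [hab, hbc', hβ]; module
    have hac' : a * τ b = τ b - b := by rw [hac, hbc', hβ]; module
    -- The span of `a, b, τ b` contains three idempotents, exchanged suitably by `τ`, which form a
    -- `3C(2)` basis.
    refine algIso_of_table _ ![a, a - (2 : F) • b - τ b, a - b - (2 : F) • τ b] ?_ ?_ {a, b}
      h.generates ?_
    · have ha : ∀ p q : F, a ≠ p • b + q • τ b := by
        intro p q hpq
        have h1 := congrArg τ hpq
        rw [h.τ_a, map_add, map_smul, map_smul, h.ττ, hpq] at h1
        have h2 := h.linIndep (p := p - q) (q := q - p) (by linear_combination (norm := module) h1)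
        obtain rfl : p = q := sub_eq_zero.1 h2.1
        have h3 := hab'
        rw [hpq, add_mul, smul_mul_assoc, smul_mul_assoc, h.idem_b, mul_comm (τ b), hbc'] at h3
        obtain ⟨h4, h5⟩ := h.linIndep (p := -1) (q := 1 - p)
          (by linear_combination (norm := module) h3)
        exact one_ne_zero (neg_eq_zero.1 h4)
      -- In characteristic `3`, `β = 2` would coincide with `α = -1`.
      have h3 : (3 : F) ≠ 0 := by
        intro h3
        exact h.pair.alpha_ne_beta (by rw [hβ]; linear_combination -h3)
      rw [Fintype.linearIndependent_iff]
      intro f hf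
      simp only [Fin.sum_univ_three, Matrix.cons_val_zero, Matrix.cons_val_one,
        Matrix.cons_val] at hf
      have h0 : f 0 + f 1 + f 2 = 0 := by
        by_contra h0
        refine ha ((f 0 + f 1 + f 2)⁻¹ * (2 * f 1 + f 2)) ((f 0 + f 1 + f 2)⁻¹ * (f 1 + 2 * f 2)) ?_
        have h1 : (f 0 + f 1 + f 2) • a = (2 * f 1 + f 2) • b + (f 1 + 2 * f 2) • τ b := by
          linear_combination (norm := module) hf
        have h1 := congrArg ((f 0 + f 1 + f 2)⁻¹ • ·) h1
        simpa only [smul_add, smul_smul, inv_mul_cancel₀ h0, one_smul] using h1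
      obtain ⟨h1, h2⟩ := h.linIndep (p := -(2 * f 1 + f 2)) (q := -(f 1 + 2 * f 2)) (by
        have : (f 0 + f 1 + f 2) • a = 0 := by rw [h0, zero_smul]
        linear_combination (norm := module) hf - this)
      have h4 : f 1 = 0 := by
        have : 3 * f 1 = 0 := by linear_combination h2 - 2 * h1
        exact (mul_eq_zero.1 this).resolve_left h3
      have h5 : f 2 = 0 := by linear_combination -h1 - 2 * h4
      have h6 : f 0 = 0 := by linear_combination h0 - h4 - h5
      intro i
      fin_cases i
      exacts [h6, h4, h5]
    · intro i j
      fin_cases i <;> fin_cases j <;>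
        simp [Fin.sum_univ_three, div_self h20, mul_sub, sub_mul, mul_smul_comm, smul_mul_assoc,
          h.idem_a, h.idem_b, hcc, hab', hac', hbc', mul_comm b a, mul_comm (τ b) b,
          mul_comm (τ b) a] <;> module
    · rintro y (rfl | rfl)
      · exact Submodule.subset_span ⟨0, rfl⟩
      · have h3 : (3 : F) ≠ 0 := by
          intro h3
          exact h.pair.alpha_ne_beta (by rw [hβ]; linear_combination -h3)
        rw [SetLike.mem_coe, Submodule.mem_span_range_iff_exists_fun]
        refine ⟨![1 / 3, -(2 / 3), 1 / 3], ?_⟩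
        simp only [Fin.sum_univ_three, Matrix.cons_val_zero, Matrix.cons_val_one, Matrix.cons_val]
        match_scalars <;> field_simp <;> ring
  · unfold ThreeCSkew
    rw [if_neg hα1]
    have hα1' : α + 1 ≠ 0 := fun h0 => hα1 (by linear_combination h0)
    -- The scaled sum `(α + 1)⁻¹ • (b + τ b + x)` acts as an identity on `b, τ b, x`; the claim is
    -- that `a` is this identity minus `x`.
    have hn : a + x - (α + 1)⁻¹ • (b + τ b + x) = 0 := by
      have e1 : ∀ y : A, y * (b + τ b + x) = (α + 1) • y →
          y * ((α + 1)⁻¹ • (b + τ b + x)) = y := by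
        intro y hy
        rw [mul_smul_comm, hy, smul_smul, inv_mul_cancel₀ hα1', one_smul]
      apply h.eq_zero_of_mul_eq
      · have h1 : a * (b + τ b + x) = b + τ b + x - (α + 1) • x := by
          rw [mul_add, mul_add, hab, hac, hax, hbc, hβ]
          linear_combination (norm := module) E (b + τ b - x)
        rw [mul_sub, mul_add, h.idem_a, hax, mul_smul_comm, h1, smul_sub, smul_smul,
          inv_mul_cancel₀ hα1', one_smul]
        module
      · rw [mul_sub, e1, mul_add, mul_comm b a, hab, hbc, hbx, hβ]
        · nth_rw 1 [← e2]
          module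
        · rw [mul_add, mul_add, h.idem_b, hbc, hbx]
          linear_combination (norm := module) E b
    refine algIso_of_table _ ![b, τ b, x] (h.threeC_indep hα1 hτx hbc hbx) ?_ {a, b}
      h.generates ?_
    · intro i j
      fin_cases i <;> fin_cases j <;>
        simp [Fin.sum_univ_three, h.idem_b, hcc, hxx, hbc, hbx, hcx, mul_comm (τ b) b,
          mul_comm x] <;> module
    · rintro y (rfl | rfl)
      · rw [SetLike.mem_coe, Submodule.mem_span_range_iff_exists_fun]
        refine ⟨![(α + 1)⁻¹, (α + 1)⁻¹, (α + 1)⁻¹ - 1], ?_⟩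
        simp only [Fin.sum_univ_three, Matrix.cons_val_zero, Matrix.cons_val_one, Matrix.cons_val]
        linear_combination (norm := module) -hn
      · exact Submodule.subset_span ⟨0, rfl⟩

/-! ### The case `b * τ b = 0`. -/

/-- Now `σ` fixes both `b` and `τ b`, so applying `τ ∘ σ` twice to `a` gives the idempotent `a - κ •
(b - τ b)`. The two coordinates of its idempotence add up to `2 κ² = 0`. -/
theorem τσ_a_of_mul_eq_zero (h : SkewPair α β a b σ τ) (hbc : b * τ b = 0) :
    τ (σ a) = σ a ∧ b * a = β • b + (α / 2) • (a - σ a) := by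
  have h20 := h.two_ne
  have hα := h.pair.alpha_ne_zero
  obtain ⟨l, φ, hl, -⟩ := h.exists_mul
  have hw := h.τσ_a hl
  have hκ : α * (2 * (β - l) / α) = 2 * (β - l) := by field_simp
  generalize 2 * (β - l) / α = κ at *
  have hcc : τ b * τ b = τ b := by rw [← h.map_τ, h.idem_b]
  have hσc := h.σ_of_mul_eq_zero hbc
  have h1 : τ (σ (τ (σ a))) = a - κ • (b - τ b) := by
    rw [hw]
    simp only [map_add, map_sub, map_smul, h.σσ, h.ττ, h.τ_a, h.σ_b, hσc]
    module
  have h2 : (a - κ • (b - τ b)) * (a - κ • (b - τ b)) = a - κ • (b - τ b) := by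
    rw [← h1]
    simp only [← h.map_σ, ← h.map_τ, h.idem_a]
  have h3 : (b - τ b) * (b - τ b) = b + τ b := by
    rw [mul_sub, sub_mul, sub_mul, h.idem_b, hcc, mul_comm (τ b), hbc]
    module
  have hd := h.mul_sub_τ b
  have h4 : (κ ^ 2 - 2 * κ * β + κ) • b + (κ ^ 2 + 2 * κ * β - κ) • τ b = 0 := by
    generalize hdd : b - τ b = d at *
    rw [mul_sub, sub_mul, sub_mul, h.idem_a, mul_smul_comm, smul_mul_assoc, smul_mul_assoc,
      mul_smul_comm, mul_comm d, hd, h3] at h2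
    rw [← hdd] at h2
    linear_combination (norm := module) h2
  obtain ⟨h5, h6⟩ := h.linIndep h4
  have h7 : 2 * κ ^ 2 = 0 := by linear_combination h5 + h6
  have h8 : κ = 0 := pow_eq_zero_iff two_ne_zero |>.1 ((mul_eq_zero.1 h7).resolve_left h20)
  subst h8
  have h9 : l = β := by
    rw [mul_zero] at hκ
    exact (sub_eq_zero.1 ((mul_eq_zero.1 hκ.symm).resolve_left h20)).symm
  subst h9
  exact ⟨by rw [hw, zero_smul, add_zero], hl⟩

/-- The multiplication table in the case `b * τ b = 0`. -/
theorem qTwo_table (h : SkewPair α β a b σ τ) (hbc : b * τ b = 0) :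
    τ (σ a) = σ a ∧ a * b = β • b + (α / 2) • (a - σ a) ∧
    a * τ b = β • τ b + (α / 2) • (a - σ a) ∧
    b * σ a = β • b + (α / 2) • (σ a - a) ∧
    τ b * σ a = β • τ b + (α / 2) • (σ a - a) ∧
    α • (a * σ a) = (β - α) • (β • (b + τ b) - α • a - α • σ a) ∧
    a * (a * (b + τ b)) - α • (a * (b + τ b)) = (2 * α * (β - α) + α) • a := by
  obtain ⟨hw, hl⟩ := h.τσ_a_of_mul_eq_zero hbc
  obtain ⟨m, h1, h2, h3⟩ := h.relation hl
  have h4 := h.τ_mul_ba hl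
  have h5 := h.σ_mul_ba hl
  have h6 := congrArg τ h5
  simp only [h.map_τ, map_add, map_sub, map_smul, h.τ_a, hw] at h6
  rw [hw] at h4
  rw [h.σ_of_mul_eq_zero hbc, sub_self, smul_zero] at h3
  -- The left side of `relation` vanishes because `σ` fixes `τ b`; as `σ a ≠ a`, this fixes the
  -- scalar `m`.
  have h7 := (smul_eq_zero.1 h3.symm).resolve_right (sub_ne_zero.2 h.σ_a_ne.symm)
  have h8 : m = 2 * α * (β - α) + α := by linear_combination h7
  subst h8
  rw [mul_comm b] at hl
  rw [mul_comm (τ b)] at h4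
  refine ⟨hw, hl, h4, h5, h6, ?_, h1⟩
  rw [h2]
  module

/-- With `β = α γ`, one fusion rule at each axis gives one equation: `hE` from `0 ⋆ 0` at `b`, `hC`
from `α ⋆ α` at `a`. Adding `hE` and twice `hC` gives `γ = 2`. -/
theorem qTwo_scalars (h : SkewPair α β a b σ τ) (hbc : b * τ b = 0) : 3 * α = 1 ∧ β = 2 * α := by
  obtain ⟨hw, hab, hac, hbw, hcw, haw, hm⟩ := h.qTwo_table hbc
  have h20 := h.two_ne
  have hp := h.pair
  obtain ⟨hα, hα1, hβ, hβ1, hαβ⟩ := hp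
  obtain ⟨γ, rfl⟩ : ∃ γ, β = α * γ := ⟨β / α, by field_simp⟩
  have hγ : γ ≠ 0 := right_ne_zero_of_mul hβ
  have haw' : a * σ a = (α * (γ - 1)) • (γ • (b + τ b) - a - σ a) := by
    have : α • (a * σ a - (α * (γ - 1)) • (γ • (b + τ b) - a - σ a)) = 0 := by
      linear_combination (norm := module) haw
    exact sub_eq_zero.1 ((smul_eq_zero.1 this).resolve_left hα)
  have hww : σ a * σ a = σ a := by rw [← h.map_σ, h.idem_a]
  have hcc : τ b * τ b = τ b := by rw [← h.map_τ, h.idem_b]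
  have hs : (b + τ b) * (b + τ b) = b + τ b := by
    rw [mul_add, add_mul, add_mul, h.idem_b, hcc, mul_comm (τ b), hbc]
    module
  have e2 : ∀ y : A, (α / 2) • y + (α / 2) • y = α • y := fun y => by
    have : NeZero (2 : F) := ⟨h20⟩
    rw [← add_smul, add_halves]
  have has : a * (b + τ b) = (α * γ) • (b + τ b) + α • (a - σ a) := by
    rw [mul_add, hab, hac]
    linear_combination (norm := module) e2 (a - σ a)
  have hsw : (b + τ b) * σ a = (α * γ) • (b + τ b) + α • (σ a - a) := by
    rw [add_mul, hbw, hcw]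
    linear_combination (norm := module) e2 (σ a - a)
  have hbs : b * (b + τ b) = b := by rw [mul_add, h.idem_b, hbc, add_zero]
  have hσs : σ (b + τ b) = b + τ b := by rw [map_add, h.σ_b, h.σ_of_mul_eq_zero hbc]
  have hba : b * a = (α * γ) • b + (α / 2) • (a - σ a) := by rw [mul_comm, hab]
  have hE : γ - 4 * α * γ + 2 * α = 0 := by
    -- Subtracting from `a + σ a` its projection to `b` leaves a `0`-eigenvector of `b`.
    have h1 := h.zero_b (a + σ a - (2 * (α * γ)) • b) (by
      rw [mul_sub, mul_add, hba, hbw, mul_smul_comm, h.idem_b]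
      module)
    have h2 : (a + σ a - (2 * (α * γ)) • b) * (a + σ a - (2 * (α * γ)) • b) =
        a + σ a + (2 * α * (γ - 1)) • (γ • (b + τ b) - a - σ a)
          - (4 * (α * γ) ^ 2) • b := by
      simp only [mul_sub, sub_mul, mul_add, add_mul, mul_smul_comm, smul_mul_assoc, h.idem_a,
        h.idem_b, hww, mul_comm a b, mul_comm (σ a), hba, hbw, haw']
      module
    rw [h2] at h1
    generalize b + τ b = s at *
    simp only [mul_sub, mul_add, mul_smul_comm, hba, hbw, hbs, h.idem_b] at h1
    have h3 : (2 * (α * γ) * (γ - 4 * α * γ + 2 * α)) • b = 0 := by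
      linear_combination (norm := module) h1
    have h4 := h.smul_b h3
    exact (mul_eq_zero.1 h4).resolve_left (mul_ne_zero h20 hβ)
  have hC : 2 * α * γ - α - 1 = 0 := by
    have hy : (1 - α) • (a * (b + τ b)) - (2 * α * (α * γ - α) + α) • a =
        ((1 - α) * (α * γ)) • (b + τ b) - (α ^ 2 * (2 * γ - 1)) • a
          - ((1 - α) * α) • σ a := by
      rw [has]
      module
    -- This is a multiple of the `α`-part of `b + τ b` at `a`; multiplying its square by `a` must
    -- give a multiple of `a`.
    obtain ⟨ν, hν⟩ := h.alpha_a
      ((1 - α) • (a * (b + τ b)) - (2 * α * (α * γ - α) + α) • a) (by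
        rw [mul_sub, mul_smul_comm, mul_smul_comm, h.idem_a]
        linear_combination (norm := module) (1 - α) • hm)
    rw [hy] at hν
    have hsplit : ∃ ρ : F, (2 * α * γ - α - 1) • (γ • (b + τ b) - σ a) = ρ • a := by
      -- Modulo `hE`, the coefficient arising from the squared `α`-part reduces to a nonzero
      -- multiple of `2 α γ - α - 1`.
      have hI : (1 - α) * α ^ 3 * ((1 - α) * γ ^ 2 * (1 - 2 * α)
          + (1 - α) * (γ - 1) * (1 - 2 * α * γ) - 2 * α ^ 2 * (2 * γ - 1)) =
          (1 - α) * α ^ 3 * (2 * α * γ - α - 1) := by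
        linear_combination (1 - α) * α ^ 3 * ((1 - α) * γ + α + 1) * hE
      have hu : (1 - α) * α ^ 3 ≠ 0 :=
        mul_ne_zero (sub_ne_zero.2 hα1.symm) (pow_ne_zero 3 hα)
      clear hy hab hac hcw hbw hbs hσs hba haw hm
      generalize b + τ b = s at *
      generalize hAA : (1 - α) * (α * γ) = A₀ at *
      generalize hBB : α ^ 2 * (2 * γ - 1) = B₀ at *
      generalize hDD : (1 - α) * α = D₀ at *
      have hy2 : (A₀ • s - B₀ • a - D₀ • σ a) * (A₀ • s - B₀ • a - D₀ • σ a) =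
          (A₀ ^ 2 - 2 * A₀ * B₀ * (α * γ) - 2 * A₀ * D₀ * (α * γ)
            + 2 * B₀ * D₀ * (α * (γ - 1)) * γ) • s
          + (B₀ ^ 2 - 2 * A₀ * B₀ * α + 2 * A₀ * D₀ * α - 2 * B₀ * D₀ * (α * (γ - 1))) • a
          + (D₀ ^ 2 + 2 * A₀ * B₀ * α - 2 * A₀ * D₀ * α
            - 2 * B₀ * D₀ * (α * (γ - 1))) • σ a := by
        simp only [mul_sub, sub_mul, mul_smul_comm, smul_mul_assoc, hs, h.idem_a, hww,
          mul_comm s a, mul_comm (σ a), has, hsw, haw']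
        module
      rw [hy2] at hν
      generalize hPP : A₀ ^ 2 - 2 * A₀ * B₀ * (α * γ) - 2 * A₀ * D₀ * (α * γ)
            + 2 * B₀ * D₀ * (α * (γ - 1)) * γ = P₀ at *
      generalize B₀ ^ 2 - 2 * A₀ * B₀ * α + 2 * A₀ * D₀ * α - 2 * B₀ * D₀ * (α * (γ - 1)) = Q₀ at *
      generalize hRR : D₀ ^ 2 + 2 * A₀ * B₀ * α - 2 * A₀ * D₀ * α
            - 2 * B₀ * D₀ * (α * (γ - 1)) = R₀ at *
      simp only [mul_add, mul_smul_comm, has, h.idem_a, haw'] at hν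
      have hC : P₀ * α + R₀ * (α * (γ - 1)) = (1 - α) * α ^ 3 * (2 * α * γ - α - 1) := by
        rw [← hI, ← hPP, ← hRR, ← hAA, ← hBB, ← hDD]
        ring
      have h1 : (P₀ * α + R₀ * (α * (γ - 1))) • (γ • s - σ a) =
          (ν - P₀ * α - Q₀ + R₀ * (α * (γ - 1))) • a := by
        linear_combination (norm := module) hν
      rw [hC] at h1
      have h2 := congrArg (((1 - α) * α ^ 3)⁻¹ • ·) h1
      rw [smul_smul, smul_smul, inv_mul_cancel_left₀ hu] at h2
      exact ⟨_, h2⟩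
    obtain ⟨ρ, hρ⟩ := hsplit
    by_contra hC
    -- If the coefficient were nonzero, applying `σ` would give `γ • (b + τ b) = a + σ a`;
    -- multiplying by `b` then yields `α = 1/2`, and `hE` gives `γ = 1`, that is `α = β`.
    have h1 := congrArg σ hρ
    rw [map_smul, map_sub, map_smul, map_smul, hσs, h.σσ] at h1
    have h2 : (2 * α * γ - α - 1 - ρ) • (a - σ a) = 0 := by
      linear_combination (norm := module) hρ - h1
    have h3 := (smul_eq_zero.1 h2).resolve_right (sub_ne_zero.2 h.σ_a_ne.symm)
    obtain rfl : 2 * α * γ - α - 1 = ρ := sub_eq_zero.1 h3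
    have h4 : γ • (b + τ b) - σ a - a = 0 := by
      refine (smul_eq_zero.1 ?_).resolve_left hC
      rw [smul_sub, hρ, sub_self]
    have h5 := congrArg (b * ·) h4
    simp only [mul_sub, mul_smul_comm, hbs, hba, hbw, mul_zero] at h5
    have h6 : (γ * (1 - 2 * α)) • b = 0 := by linear_combination (norm := module) h5
    have h7 := (mul_eq_zero.1 (h.smul_b h6)).resolve_left hγ
    exact hαβ (by linear_combination α * (hE - 2 * γ * h7 + h7))
  have hγ2 : γ = 2 := by linear_combination hE + 2 * hC
  subst hγ2
  exact ⟨by linear_combination hC, mul_comm _ _⟩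

/-- The involutions `τ` and `σ` make any relation symmetric in `b, τ b` and in `a, σ a`, and
multiplying by `b` fixes the remaining ratio. A nonzero relation would make `a + σ a` a multiple of
`b + τ b`; multiplying by `a` and then by `b` leads to `σ a = a`. -/
theorem qTwo_indep (h : SkewPair α β a b σ τ) (hbc : b * τ b = 0) {p q r t : F}
    (hf : p • a + q • b + r • τ b + t • σ a = 0) : p = 0 ∧ q = 0 ∧ r = 0 ∧ t = 0 := by
  obtain ⟨hw, hab, hac, hbw, hcw, haw, -⟩ := h.qTwo_table hbc
  obtain ⟨h3, h2⟩ := h.qTwo_scalars hbc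
  have h20 := h.two_ne
  have hα := h.pair.alpha_ne_zero
  have h30 : (3 : F) ≠ 0 := left_ne_zero_of_mul_eq_one h3
  have hσc := h.σ_of_mul_eq_zero hbc
  have h4 := congrArg τ hf
  simp only [map_add, map_smul, h.τ_a, h.ττ, hw, map_zero] at h4
  have h5 := h.smul_b_sub (p := q - r) (by linear_combination (norm := module) hf - h4)
  obtain rfl : q = r := sub_eq_zero.1 h5
  have h6 := congrArg σ hf
  simp only [map_add, map_smul, h.σσ, h.σ_b, hσc, map_zero] at h6
  have h7 : (p - t) • (a - σ a) = 0 := by linear_combination (norm := module) hf - h6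
  have h8 := (smul_eq_zero.1 h7).resolve_right (sub_ne_zero.2 h.σ_a_ne.symm)
  obtain rfl : p = t := sub_eq_zero.1 h8
  have h9 := congrArg (b * ·) hf
  simp only [mul_add, mul_smul_comm, h.idem_b, hbc, hbw, mul_comm b a, hab, mul_zero] at h9
  have h10 := h.smul_b (p := 2 * p * β + q) (by linear_combination (norm := module) h9)
  obtain rfl : q = -(2 * p * β) := by linear_combination h10
  suffices hp : p = 0 by subst hp; simp
  by_contra hp
  have h11 : a + σ a - (2 * β) • (b + τ b) = 0 := by
    refine (smul_eq_zero.1 ?_).resolve_left hp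
    linear_combination (norm := module) hf
  subst h2
  have h12 := congrArg (a * ·) h11
  simp only [mul_add, mul_sub, mul_smul_comm, h.idem_a, hab, hac, mul_zero] at h12
  obtain rfl : α = 1 / 3 := by field_simp; linear_combination h3
  have h13 : a * σ a = (1 / 3 : F) • ((2 : F) • (b + τ b) - a - σ a) := by
    have : (1 / 3 : F) • (a * σ a - (1 / 3 : F) • ((2 : F) • (b + τ b) - a - σ a)) = 0 := by
      linear_combination (norm := module) haw
    exact sub_eq_zero.1 ((smul_eq_zero.1 this).resolve_left hα)
  rw [h13] at h12
  have h14 : σ a = (4 / 3 : F) • (b + τ b) - a := by linear_combination (norm := module) h11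
  have h15 : (3 : F) • a = (2 : F) • (b + τ b) := by
    rw [h14] at h12
    have := congrArg ((27 : F) • ·) h12
    simp only [smul_zero] at this
    linear_combination (norm := skip) this
    match_scalars <;> field_simp <;> ring
  have h16 := congrArg (b * ·) h15
  simp only [mul_add, mul_smul_comm, h.idem_b, hbc, mul_comm b a, hab] at h16
  have h17 : (1 / 2 : F) • (a - σ a) = 0 := by
    linear_combination (norm := skip) h16
    match_scalars <;> field_simp <;> ring
  refine h.σ_a_ne (sub_eq_zero.1 ((smul_eq_zero.1 h17).resolve_left ?_)).symm
  exact one_div_ne_zero h20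

/-- The elements `b, τ b` play `s₁, s₂`, and `d₁, d₂` are the two combinations interchanged by `σ`.
Their `a, σ a` coordinates form a matrix of determinant `-5`, invertible exactly outside
characteristic `5`. -/
theorem algIso_qTwo (h : SkewPair α β a b σ τ) (hbc : b * τ b = 0) (h50 : (5 : F) ≠ 0) :
    AlgIso F A (QTwo F) := by
  obtain ⟨hw, hab, hac, hbw, hcw, haw, -⟩ := h.qTwo_table hbc
  obtain ⟨h3, rfl⟩ := h.qTwo_scalars hbc
  have h20 := h.two_ne
  have hα := h.pair.alpha_ne_zero
  have h30 : (3 : F) ≠ 0 := left_ne_zero_of_mul_eq_one h3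
  have h60 : (6 : F) ≠ 0 := by
    rw [show (6 : F) = 2 * 3 by norm_num]
    exact mul_ne_zero h20 h30
  obtain rfl : α = 1 / 3 := by field_simp; linear_combination h3
  have hcc : τ b * τ b = τ b := by rw [← h.map_τ, h.idem_b]
  have hww : σ a * σ a = σ a := by rw [← h.map_σ, h.idem_a]
  have haw' : a * σ a = (1 / 3 : F) • ((2 : F) • (b + τ b) - a - σ a) := by
    have : (1 / 3 : F) • (a * σ a - (1 / 3 : F) • ((2 : F) • (b + τ b) - a - σ a)) = 0 := by
      linear_combination (norm := module) haw
    exact sub_eq_zero.1 ((smul_eq_zero.1 this).resolve_left hα)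
  refine algIso_of_table _ ![b, τ b, (2 : F) • a + (3 : F) • σ a - (3 : F) • b - (3 : F) • τ b,
    (3 : F) • a + (2 : F) • σ a - (3 : F) • b - (3 : F) • τ b] ?_ ?_ {a, b} h.generates ?_
  · rw [Fintype.linearIndependent_iff]
    intro f hf
    simp only [Fin.sum_univ_four, Matrix.cons_val_zero, Matrix.cons_val_one,
      Matrix.cons_val] at hf
    obtain ⟨k1, k2, k3, k4⟩ := h.qTwo_indep hbc (p := 2 * f 2 + 3 * f 3)
      (q := f 0 - 3 * f 2 - 3 * f 3) (r := f 1 - 3 * f 2 - 3 * f 3) (t := 3 * f 2 + 2 * f 3)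
      (by linear_combination (norm := module) hf)
    have k5 : 5 * f 2 = 0 := by linear_combination 3 * k4 - 2 * k1
    have k6 : 5 * f 3 = 0 := by linear_combination 3 * k1 - 2 * k4
    have k7 := (mul_eq_zero.1 k5).resolve_left h50
    have k8 := (mul_eq_zero.1 k6).resolve_left h50
    have k9 : f 0 = 0 := by linear_combination k2 + 3 * k7 + 3 * k8
    have k10 : f 1 = 0 := by linear_combination k3 + 3 * k7 + 3 * k8
    intro i
    fin_cases i
    exacts [k9, k10, k7, k8]
  · intro i j
    fin_cases i <;> fin_cases j <;>
      simp only [Fin.zero_eta, Fin.mk_one, Fin.reduceFinMk, Fin.sum_univ_four,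
        Matrix.cons_val_zero, Matrix.cons_val_one, Matrix.cons_val, mul_sub, sub_mul, mul_add,
        add_mul, mul_smul_comm, smul_mul_assoc,
        h.idem_a, h.idem_b, hcc, hww, hab, hac, hbc, hbw, hcw, haw', mul_comm b a,
        mul_comm (τ b) b, mul_comm (τ b) a, mul_comm (σ a)] <;>
      match_scalars <;> field_simp <;> ring
  · rintro y (rfl | rfl)
    · rw [SetLike.mem_coe, Submodule.mem_span_range_iff_exists_fun]
      refine ⟨![3 / 5, 3 / 5, -(2 / 5), 3 / 5], ?_⟩
      simp only [Fin.sum_univ_four, Matrix.cons_val_zero, Matrix.cons_val_one, Matrix.cons_val]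
      match_scalars <;> field_simp <;> ring
    · exact Submodule.subset_span ⟨0, rfl⟩

/-- In characteristic `5` the elements `d₁, d₂` become dependent modulo `b, τ b`. So `d₂` is
replaced by `3 (a + σ a - b - τ b)`, the identity of the algebra, and `a` is this identity minus
`d₁`. -/
theorem algIso_qTwoQuotientUnit (h : SkewPair α β a b σ τ) (hbc : b * τ b = 0) [CharP F 5] :
    AlgIso F A (QTwoQuotientUnit F) := by
  obtain ⟨hw, hab, hac, hbw, hcw, haw, -⟩ := h.qTwo_table hbc
  obtain ⟨h3, rfl⟩ := h.qTwo_scalars hbc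
  have h20 := h.two_ne
  have h50 : (5 : F) = 0 := CharP.ofNat_eq_zero F 5
  -- In characteristic `5`, `1/3` equals `2`.
  obtain rfl : α = 2 := by linear_combination 2 * h3 - α * h50
  rw [div_self h20, one_smul] at hab hac hbw hcw
  have hcc : τ b * τ b = τ b := by rw [← h.map_τ, h.idem_b]
  have hww : σ a * σ a = σ a := by rw [← h.map_σ, h.idem_a]
  have haw' : a * σ a = (2 : F) • ((2 : F) • (b + τ b) - a - σ a) := by
    have : (2 : F) • (a * σ a - (2 : F) • ((2 : F) • (b + τ b) - a - σ a)) = 0 := by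
      linear_combination (norm := module) haw
    exact sub_eq_zero.1 (h.half_smul this)
  refine algIso_of_table _ ![b, τ b, (2 : F) • a + (3 : F) • σ a - (3 : F) • b - (3 : F) • τ b,
    (3 : F) • a + (3 : F) • σ a - (3 : F) • b - (3 : F) • τ b] ?_ ?_ {a, b} h.generates ?_
  · rw [Fintype.linearIndependent_iff]
    intro f hf
    simp only [Fin.sum_univ_four, Matrix.cons_val_zero, Matrix.cons_val_one,
      Matrix.cons_val] at hf
    obtain ⟨k1, k2, k3, k4⟩ := h.qTwo_indep hbc (p := 2 * f 2 + 3 * f 3)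
      (q := f 0 - 3 * f 2 - 3 * f 3) (r := f 1 - 3 * f 2 - 3 * f 3) (t := 3 * f 2 + 3 * f 3)
      (by linear_combination (norm := module) hf)
    have k7 : f 2 = 0 := by linear_combination k4 - k1
    have k8 : f 3 = 0 := by linear_combination 2 * k1 - 4 * k7 - f 3 * h50
    have k9 : f 0 = 0 := by linear_combination k2 + 3 * k7 + 3 * k8
    have k10 : f 1 = 0 := by linear_combination k3 + 3 * k7 + 3 * k8
    intro i
    fin_cases i
    exacts [k9, k10, k7, k8]
  · intro i j
    fin_cases i <;> fin_cases j <;>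
      simp only [Fin.zero_eta, Fin.mk_one, Fin.reduceFinMk, Fin.sum_univ_four,
        Matrix.cons_val_zero, Matrix.cons_val_one, Matrix.cons_val, mul_sub, sub_mul, mul_add,
        add_mul, mul_smul_comm, smul_mul_assoc,
        h.idem_a, h.idem_b, hcc, hww, hab, hac, hbc, hbw, hcw, haw', mul_comm b a,
        mul_comm (τ b) b, mul_comm (τ b) a, mul_comm (σ a)] <;>
      -- The table holds only modulo `5`: each coordinate difference is an integer multiple of `5`.
      match_scalars <;> first
        | ring1
        | linear_combination h50
        | linear_combination -h50
        | linear_combination 4 * h50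
        | linear_combination -2 * h50
        | linear_combination -4 * h50
        | linear_combination -6 * h50
        | linear_combination -12 * h50
  · rintro y (rfl | rfl)
    · rw [SetLike.mem_coe, Submodule.mem_span_range_iff_exists_fun]
      refine ⟨![0, 0, -1, 1], ?_⟩
      simp only [Fin.sum_univ_four, Matrix.cons_val_zero, Matrix.cons_val_one, Matrix.cons_val]
      module
    · exact Submodule.subset_span ⟨0, rfl⟩

end SkewPair

/-! ### From axes and axets to the two-involution setting. -/

section

variable {F A : Type*} [Field F] [NonUnitalNonAssocCommRing A] [Module F A]
  [SMulCommClass F A A] [IsScalarTower F A A] {α β : F}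

theorem IsAxis.exists_decomposition {a : A} (h : IsAxis α β a) (v : A) :
    ∃ (μ : F) (x y z : A), v = μ • a + x + y + z ∧ x ∈ eigen F a 0 ∧ y ∈ eigen F a α ∧
      z ∈ eigen F a β := by
  refine h.induction (p := fun v => ∃ (μ : F) (x y z : A), v = μ • a + x + y + z ∧
    x ∈ eigen F a 0 ∧ y ∈ eigen F a α ∧ z ∈ eigen F a β) ?_ ?_ ?_ v
  · intro i v hv
    cases i with
    | one =>
      have hv' : v ∈ eigen F a 1 := hv
      rw [h.primitive, Submodule.mem_span_singleton] at hv'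
      obtain ⟨μ, rfl⟩ := hv'
      exact ⟨μ, 0, 0, 0, by simp, zero_mem _, zero_mem _, zero_mem _⟩
    | zero => exact ⟨0, v, 0, 0, by simp, hv, zero_mem _, zero_mem _⟩
    | alpha => exact ⟨0, 0, v, 0, by simp, zero_mem _, hv, zero_mem _⟩
    | beta => exact ⟨0, 0, 0, v, by simp, zero_mem _, zero_mem _, hv⟩
  · exact ⟨0, 0, 0, 0, by simp, zero_mem _, zero_mem _, zero_mem _⟩
  · rintro v w ⟨μ, x, y, z, rfl, hx, hy, hz⟩ ⟨μ', x', y', z', rfl, hx', hy', hz'⟩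
    exact ⟨μ + μ', x + x', y + y', z + z', by module, add_mem hx hx', add_mem hy hy',
      add_mem hz hz'⟩

/-- The `C₂`-grading of the Jordan type fusion law obtained by ignoring `β`. -/
def jordanGrade : MonsterLabel → ℤˣ
  | .alpha => -1
  | _ => 1

theorem jordanGrade_star (i j k : MonsterLabel) (hi : i ≠ .beta) (hj : j ≠ .beta)
    (h : k ∈ MonsterLabel.star i j) : jordanGrade k = jordanGrade i * jordanGrade j := by
  cases i <;> cases j <;> cases k <;> simp_all [MonsterLabel.star, jordanGrade]

/-- An axis without `β`-eigenvectors has an involution negating its `α`-eigenspace. -/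
theorem IsAxis.exists_jordan_involution (hp : IsMonsterPair α β) {b : A} (h : IsAxis α β b)
    (hβ : ∀ v, b * v = β • v → v = 0) :
    ∃ σ : A →ₗ[F] A, (∀ x y, σ (x * y) = σ x * σ y) ∧
      ∀ i : MonsterLabel, ∀ v ∈ eigen F b (i.value α β), σ v = jordanGrade i • v := by
  have hD : α * (α - 1) ≠ 0 := mul_ne_zero hp.alpha_ne_zero (sub_ne_zero.2 hp.alpha_ne_one)
  let m : A →ₗ[F] A := LinearMap.mulLeft F b
  -- A polynomial in `ad b` with value `1` at the eigenvalues `0` and `1`, and `-1` at `α`.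
  let L : A →ₗ[F] A := LinearMap.id - (2 / (α * (α - 1))) • (m ∘ₗ (m - LinearMap.id))
  have hz : ∀ v ∈ eigen F b (MonsterLabel.beta.value α β), v = 0 := fun v hv =>
    hβ v (mem_eigen.1 hv)
  have hL : ∀ i : MonsterLabel, ∀ v ∈ eigen F b (i.value α β), L v = jordanGrade i • v := by
    intro i v hv
    by_cases hi : i = .beta
    · subst hi
      rw [hz v hv, map_zero, smul_zero]
    rw [mem_eigen] at hv
    have e : L v = (1 - (2 / (α * (α - 1))) * (i.value α β * (i.value α β - 1))) • v := by
      simp only [L, m, LinearMap.sub_apply, LinearMap.smul_apply, LinearMap.comp_apply,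
        LinearMap.id_apply, LinearMap.mulLeft_apply, mul_sub, mul_smul_comm, hv]
      module
    rw [e]
    cases i
    · simp [MonsterLabel.value, jordanGrade]
    · simp [MonsterLabel.value, jordanGrade]
    · simp only [MonsterLabel.value, jordanGrade]
      rw [div_mul_cancel₀ _ hD]
      norm_num
    · exact absurd rfl hi
  have hS : ∀ (S : Set MonsterLabel) (u : ℤˣ), (∀ k ∈ S, jordanGrade k = u) →
      ∀ v ∈ eigenSum α β b S, L v = u • v := by
    intro S u hu v hv
    refine Submodule.iSup_induction _ (motive := fun v => L v = u • v) hv (fun k w hw => ?_)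
      (by simp) (fun x y hx hy => by rw [map_add, hx, hy, smul_add])
    by_cases hk : k ∈ S
    · simp only [hk, iSup_pos] at hw
      rw [hL k w hw, hu k hk]
    · simp only [hk, iSup_neg, not_false_eq_true, Submodule.mem_bot] at hw
      simp [hw]
  refine ⟨L, ?_, hL⟩
  intro v w
  revert w
  refine h.induction (p := fun v => ∀ w, L (v * w) = L v * L w) (fun i v hv w => ?_) (by simp)
    (fun v v' hv hv' w => by rw [add_mul, map_add, map_add, hv, hv', add_mul]) v
  refine h.induction (p := fun w => L (v * w) = L v * L w) (fun j w hw => ?_) (by simp)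
    (fun w w' hw hw' => by rw [mul_add, map_add, map_add, hw, hw', mul_add]) w
  by_cases hi : i = .beta
  · subst hi
    rw [hz v hv, zero_mul, map_zero, zero_mul]
  by_cases hj : j = .beta
  · subst hj
    rw [hz w hw, mul_zero, map_zero, mul_zero]
  rw [hL i v hv, hL j w hw, hS _ _ (fun k => jordanGrade_star i j k hi hj) _
    (h.fusion i j v hv w hw)]
  simp only [Units.smul_def, Units.val_mul, smul_mul_assoc, mul_smul_comm, smul_smul]
  rw [mul_comm]

/-- The involution of `b` fixes both generators, so it is the identity; as `2 ≠ 0`, its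
`-1`-eigenspace, the `β`-eigenspace of `b`, is zero. The remaining fields are read off from
eigenvector decompositions. -/
theorem exists_skewPair (h2 : (2 : F) ≠ 0) (hp : IsMonsterPair α β) {a b : A}
    (ha : IsAxis α β a) (hb : IsAxis α β b) (hgen : NonUnitalAlgebra.adjoin F {a, b} = ⊤)
    (hba : (miyamoto hp hb).1 a = a) (hab : (miyamoto hp ha).1 b ≠ b) :
    ∃ σ τ : A →ₗ[F] A, SkewPair α β a b σ τ := by
  have hτb : ∀ x, (miyamoto hp hb).1 x = x := by
    intro x
    have hx : x ∈ NonUnitalAlgebra.adjoin F {a, b} := hgen ▸ trivial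
    induction hx using NonUnitalAlgebra.adjoin_induction with
    | mem x hx =>
      rcases hx with rfl | rfl
      · exact hba
      · exact miyamoto_apply_self hp hb
    | add x y _ _ hx hy => rw [map_add, hx, hy]
    | zero => exact map_zero _
    | mul x y _ _ hx hy => rw [Aut.map_mul, hx, hy]
    | smul r x _ hx => rw [map_smul, hx]
  have half : ∀ x : A, x = -x → x = 0 := by
    intro x hx
    have : (2 : F) • x = 0 := by
      rw [two_smul]
      nth_rw 1 [hx]
      exact neg_add_cancel x
    exact (smul_eq_zero.1 this).resolve_left h2
  have hβ : ∀ v, b * v = β • v → v = 0 := by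
    intro v hv
    have h1 := miyamoto_apply hp hb .beta v (mem_eigen.2 hv)
    rw [hτb] at h1
    exact half v (by simpa [MonsterLabel.grade] using h1)
  obtain ⟨σ, hσm, hσ⟩ := hb.exists_jordan_involution hp hβ
  have hσ0 : ∀ v, b * v = 0 → σ v = v := fun v hv => by
    simpa [jordanGrade] using hσ .zero v (mem_eigen.2 (by simpa [MonsterLabel.value] using hv))
  have hσα : ∀ v, b * v = α • v → σ v = -v := fun v hv => by
    simpa [jordanGrade] using hσ .alpha v (mem_eigen.2 hv)
  have hσb : σ b = b := by
    simpa [jordanGrade] using hσ .one b (mem_eigen.2 (by simp [MonsterLabel.value, hb.idem]))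
  have hdb : ∀ v, ∃ (μ : F) (x y : A), v = μ • b + x + y ∧ b * x = 0 ∧ b * y = α • y := by
    intro v
    obtain ⟨μ, x, y, z, hv, hx, hy, hz⟩ := hb.exists_decomposition v
    rw [mem_eigen] at hx hy hz
    rw [hβ z hz, add_zero] at hv
    exact ⟨μ, x, y, hv, by simpa using hx, hy⟩
  let τ : A →ₗ[F] A := (miyamoto hp ha).1
  have hτ0 : ∀ v, a * v = 0 → τ v = v := fun v hv =>
    (miyamoto_apply hp ha .zero v
      (mem_eigen.2 (by simpa [MonsterLabel.value] using hv))).trans (one_smul _ v)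
  have hτα : ∀ v, a * v = α • v → τ v = v := fun v hv =>
    (miyamoto_apply hp ha .alpha v (mem_eigen.2 hv)).trans (one_smul _ v)
  have hτβ : ∀ v, a * v = β • v → τ v = -v := fun v hv =>
    (miyamoto_apply hp ha .beta v (mem_eigen.2 hv)).trans (by simp [MonsterLabel.grade])
  have hτa : τ a = a := miyamoto_apply_self hp ha
  have hda : ∀ v, ∃ (μ : F) (x y z : A), v = μ • a + x + y + z ∧ a * x = 0 ∧ a * y = α • y ∧
      a * z = β • z := by
    intro v
    obtain ⟨μ, x, y, z, hv, hx, hy, hz⟩ := ha.exists_decomposition v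
    rw [mem_eigen] at hx hy hz
    exact ⟨μ, x, y, z, hv, by simpa using hx, hy, hz⟩
  have hprim : ∀ x, a * x = x → ∃ ν : F, x = ν • a := by
    intro x hx
    have h1 : x ∈ eigen F a 1 := mem_eigen.2 (by rw [hx, one_smul])
    rw [ha.primitive, Submodule.mem_span_singleton] at h1
    exact h1.imp fun _ h => h.symm
  refine ⟨σ, τ, ?_⟩
  constructor
  · exact h2
  · exact hp
  · exact ha.idem
  · exact hb.idem
  · exact hσm
  · exact Aut.map_mul _
  · intro v
    obtain ⟨μ, x, y, rfl, hx, hy⟩ := hdb v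
    simp only [map_add, map_smul, hσb, hσ0 x hx, hσα y hy, map_neg, neg_neg]
  · intro v
    exact DFunLike.congr_fun (congrArg Subtype.val (miyamoto_mul_self hp ha)) v
  · exact hσb
  · exact hτa
  · exact hab
  · intro v
    obtain ⟨μ, x, y, z, rfl, hx, hy, hz⟩ := hda v
    simp only [map_add, map_smul, hτa, hτ0 x hx, hτα y hy, hτβ z hz, mul_add, mul_sub, mul_neg,
      mul_smul_comm, hx, hy, hz, ha.idem]
    module
  · exact hτβ
  · intro v
    obtain ⟨μ, x, y, rfl, hx, hy⟩ := hdb v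
    refine ⟨μ, ?_⟩
    simp only [map_add, map_smul, hσb, hσ0 x hx, hσα y hy, mul_add, mul_smul_comm, hx, hy, hb.idem]
    match_scalars <;> field_simp <;> ring
  · intro v
    obtain ⟨μ, x, y, rfl, hx, hy⟩ := hdb v
    simp only [map_add, map_smul, hσb, hσ0 x hx, hσα y hy, mul_add, mul_sub, mul_neg,
      mul_smul_comm, hx, hy, hb.idem]
    module
  · intro v hv
    have hv' : v ∈ eigen F b (MonsterLabel.zero.value α β) :=
      mem_eigen.2 (by simpa [MonsterLabel.value] using hv)
    have h1 := hb.fusion .zero .zero v hv' v hv'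
    simp only [eigenSum, MonsterLabel.star, Set.mem_singleton_iff, iSup_iSup_eq_left,
      MonsterLabel.value, mem_eigen, zero_smul] at h1
    exact h1
  · intro v hv
    obtain ⟨μ, x, y, z, rfl, hx, hy, hz⟩ := hda v
    simp only [map_add, map_smul, hτa, hτ0 x hx, hτα y hy, hτβ z hz] at hv
    have hz0 : z = 0 := half z (add_left_cancel hv).symm
    subst hz0
    refine ⟨μ, ?_⟩
    simp only [mul_add, mul_smul_comm, hx, hy, ha.idem, mul_zero]
    module
  · intro v hv
    have hv' : v ∈ eigen F a (MonsterLabel.alpha.value α β) := mem_eigen.2 hv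
    have h1 := ha.fusion .alpha .alpha v hv' v hv'
    simp only [eigenSum, MonsterLabel.star] at h1
    rw [iSup_pair, Submodule.mem_sup] at h1
    obtain ⟨y, hy, z, hz, hyz⟩ := h1
    simp only [MonsterLabel.value, mem_eigen, zero_smul, one_smul] at hy hz
    rw [← hyz, mul_add, hy, hz, add_zero]
    exact hprim y hy
  · exact hprim
  · exact hgen

theorem generatedAxet_smul (hp : IsMonsterPair α β) (X : Set A)
    (x y : (axetOfAxes A hp).closure {x | x.1 ∈ X}) :
    ((generatedAxet hp X).τ x (-1) • y).1.1 = (miyamoto hp x.1.2).1 y.1.1 := by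
  have h : (-1 : ℤˣ) ≠ 1 := by decide
  change ((if (-1 : ℤˣ) = 1 then 1 else miyamoto hp x.1.2) • y.1).1 = _
  rw [if_neg h]
  rfl

/-- Exactly one generator corresponds to the point `a` of the skew axet. Both cannot, by
injectivity; if neither did, both involutions would act trivially on the axet. -/
theorem exists_axes_of_skewAxet (hp : IsMonsterPair α β) {X : Set A} (hcard : X.ncard = 2)
    (hX : IsAxialAlgebra α β X) (hskew : (generatedAxet hp X).IsIsomorphic skewAxet) :
    ∃ (a b : A) (ha : IsAxis α β a) (hb : IsAxis α β b), X = {a, b} ∧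
      (miyamoto hp hb).1 a = a ∧ (miyamoto hp ha).1 b ≠ b := by
  obtain ⟨e, he⟩ := hskew
  obtain ⟨u, v, huv, rfl⟩ := Set.ncard_eq_two.1 hcard
  have hu := hX.axes u (by simp)
  have hv := hX.axes v (by simp)
  have hsub := (axetOfAxes A hp).subset_closure {x | x.1 ∈ ({u, v} : Set A)}
  let pu : (axetOfAxes A hp).closure {x | x.1 ∈ ({u, v} : Set A)} := ⟨⟨u, hu⟩, hsub (Or.inl rfl)⟩
  let pv : (axetOfAxes A hp).closure {x | x.1 ∈ ({u, v} : Set A)} := ⟨⟨v, hv⟩, hsub (Or.inr rfl)⟩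
  have hfix : ∀ x y : (axetOfAxes A hp).closure {x | x.1 ∈ ({u, v} : Set A)},
      e x ≠ .a → (miyamoto hp x.1.2).1 y.1.1 = y.1.1 := by
    intro x y hx
    rw [← generatedAxet_smul hp _ x y]
    congr 2
    apply e.injective
    rw [he]
    cases hex : e x
    · exact absurd hex hx
    · cases e y <;> rfl
    · cases e y <;> rfl
  have hmove : ∀ x y : (axetOfAxes A hp).closure {x | x.1 ∈ ({u, v} : Set A)},
      e x = .a → e y ≠ .a → (miyamoto hp x.1.2).1 y.1.1 ≠ y.1.1 := by
    intro x y hx hy h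
    rw [← generatedAxet_smul hp _ x y] at h
    have h1 := congrArg e (Subtype.ext (Subtype.ext h))
    rw [he, hx] at h1
    cases hey : e y <;> rw [hey] at h1 hy
    · exact hy rfl
    · exact SkewPoint.noConfusion h1
    · exact SkewPoint.noConfusion h1
  have hne : pu ≠ pv := fun h => huv (congrArg (fun x => x.1.1) h)
  by_cases hua : e pu = .a
  · have hva : e pv ≠ .a := fun h => hne (e.injective (hua.trans h.symm))
    exact ⟨u, v, hu, hv, rfl, hfix pv pu hva, hmove pu pv hua hva⟩
  by_cases hva : e pv = .a
  · exact ⟨v, u, hv, hu, Set.pair_comm u v, hfix pu pv hua, hmove pv pu hva hua⟩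
  -- If neither generator is the point `a`, the two of them already form a closed set, leaving no
  -- room for that point in the closure.
  have hclosed : (axetOfAxes A hp).IsClosed {pu.1, pv.1} := by
    have key : ∀ x y : (axetOfAxes A hp).closure {x | x.1 ∈ ({u, v} : Set A)}, e x ≠ .a →
        ∀ s, (axetOfAxes A hp).τ x.1 s • y.1 = y.1 := by
      intro x y hx s
      change (if s = 1 then 1 else miyamoto hp x.1.2) • y.1 = y.1
      split_ifs
      · exact one_smul _ _
      · exact Subtype.ext (hfix x y hx)
    rintro y (rfl | rfl) s z (rfl | rfl)
    · rw [key pu pu hua]; simp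
    · rw [key pu pv hua]; simp
    · rw [key pv pu hva]; simp
    · rw [key pv pv hva]; simp
  have hmem := (e.symm .a).2 {pu.1, pv.1} ⟨hclosed, by
    rintro x (hx | hx)
    · exact Or.inl (Subtype.ext hx)
    · exact Or.inr (Subtype.ext hx)⟩
  exfalso
  rcases hmem with h | h
  · exact hua (by rw [← Subtype.ext h, e.apply_symm_apply])
  · exact hva (by rw [← Subtype.ext h, e.apply_symm_apply])

end

end SkewAxial

/-! ### The dichotomy and the conclusion. -/

theorem mainTheorem1 {F : Type*} [Field F] (hF : ringChar F ≠ 2)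
    {A : Type*} [NonUnitalNonAssocCommRing A] [Module F A]
    [SMulCommClass F A A] [IsScalarTower F A A]
    (α β : F) (hαβ : SkewAxial.IsMonsterPair α β)
    (X : Set A) (hcard : X.ncard = 2) (hX : SkewAxial.IsAxialAlgebra α β X)
    (hskew : (SkewAxial.generatedAxet hαβ X).IsIsomorphic SkewAxial.skewAxet) :
    (SkewAxial.AlgIso F A (SkewAxial.ThreeCSkew F α) ∧ α ≠ 1 / 2 ∧ α + β = 1) ∨
    (ringChar F ≠ 3 ∧ α = 1 / 3 ∧ β = 2 / 3 ∧
      (ringChar F ≠ 5 → SkewAxial.AlgIso F A (SkewAxial.QTwo F)) ∧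
      (ringChar F = 5 → SkewAxial.AlgIso F A (SkewAxial.QTwoQuotientUnit F))) := by
  have h20 : (2 : F) ≠ 0 := Ring.two_ne_zero hF
  obtain ⟨a, b, ha, hb, rfl, hba, hab⟩ := SkewAxial.exists_axes_of_skewAxet hαβ hcard hX hskew
  obtain ⟨σ, τ, h⟩ := SkewAxial.exists_skewPair h20 hαβ ha hb hX.generates hba hab
  obtain ⟨l, φ, hl, -⟩ := h.exists_mul
  obtain ⟨m, -, -, hm⟩ := h.relation hl
  -- This scalar is the coefficient of `a - σ a` in `relation`; its vanishing separates the two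
  -- families.
  by_cases hK : m - (2 * α * (l - α) + α) = 0
  · right
    rw [hK, zero_smul] at hm
    have hbc := h.mul_eq_zero_of_σ (sub_eq_zero.1 ((smul_eq_zero.1 hm).resolve_left
      (mul_ne_zero hαβ.beta_ne_zero (sub_ne_zero.2 hαβ.alpha_ne_beta.symm)))).symm
    obtain ⟨h3, h4⟩ := h.qTwo_scalars hbc
    have h30 : (3 : F) ≠ 0 := left_ne_zero_of_mul_eq_one h3
    refine ⟨?_, by rw [eq_div_iff h30]; linear_combination h3,
      by rw [eq_div_iff h30]; linear_combination 3 * h4 + 2 * h3, fun h5 => ?_, fun h5 => ?_⟩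
    · intro hc
      have := ringChar.Nat.cast_ringChar (R := F)
      rw [hc] at this
      exact h30 (by exact_mod_cast this)
    · refine h.algIso_qTwo hbc fun h50 => h5 ?_
      have h6 : ringChar F ∣ 5 := ringChar.dvd (by exact_mod_cast h50)
      exact ((Nat.dvd_prime Nat.prime_five).1 h6).resolve_left (CharP.ringChar_ne_one)
    · have : CharP F 5 := ringChar.of_eq h5
      exact h.algIso_qTwoQuotientUnit hbc
  · left
    have hk : σ a = a - ((β * (β - α)) / (m - (2 * α * (l - α) + α))) • (τ b - σ (τ b)) := by
      have h1 := congrArg ((m - (2 * α * (l - α) + α))⁻¹ • ·) hm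
      simp only [smul_smul, inv_mul_cancel₀ hK, one_smul] at h1
      rw [div_eq_inv_mul, h1]
      abel
    obtain ⟨h1, -⟩ := h.threeC_scalars hk
    refine ⟨h.algIso_threeC hk, fun h2 => hαβ.alpha_ne_beta ?_, h1⟩
    -- With `α + β = 1`, the value `α = 1/2` would give `β = α`.
    have h3 : α + α = 1 := by
      rw [h2]
      field_simp
      ring
    linear_combination h3 - h1
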